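/- Let $(X,d,m)$ be an Ahlfors $N$-regular metric measure space with $N>0$ and $m(X)=\infty$: open sets are measurable and there are constants $0<c\le C$ with $c\,r^N\le m(B(x,r))\le C\,r^N$ for all $x\in X$, $r>0$. Let $h:[0,\infty)\to\mathbb R$ be a nonnegative nonincreasing $C^\infty$ function with $h\equiv1$ on $[0,1/2]$ and $h\equiv0$ on $[2,\infty)$. For $t>0$ put $$T_tf(x)=\frac1{t^N}\int_X h\Big(\frac{d(x,y)}t\Big)f(y)\,dm(y),\qquad \varphi(x,t)=\frac1{T_t1(x)},\qquad \psi(x,t)=\frac1{T_t(1/T_t1)(x)},$$ $$s(x,y,t)=\frac{\varphi(x,t)\varphi(y,t)}{t^{2N}}\int_X h\Big(\frac{d(x,z)}t\Big)h\Big(\frac{d(y,z)}t\Big)\psi(z,t)\,dm(z),$$ and for $\alpha>0$ let $$k_\alpha(x,y)=\alpha\int_0^\infty\frac{t^\alpha}{(1+t^\alpha)^2}\,s(x,y,t)\,\frac{dt}t,\qquad J_\alpha g(x)=\int_X g(z)\,k_\alpha(x,z)\,dm(z).$$ The potential space is $L^{\alpha,p}=J_\alpha(L^p)$ with norm $\|f\|_{\alpha,p}=\|f\|_p+\inf\{\|g\|_p: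 g\in L^p,\ J_\alpha g=f\}$. Functions are real-valued and identified when they agree almost everywhere. $BMO$ is the space of functions $f$ integrable on balls with $\|f\|_{BMO}=\sup_B\frac1{m(B)}\int_B|f-f_B|\,dm<\infty$, where $B$ runs over all balls and $f_B=\frac1{m(B)}\int_Bf\,dm$; $C^\beta$ is the space of bounded functions $u$ with $|u(x)-u(y)|\le A\,d(x,y)^\beta$ for some $A$ and all $x,y$, with norm $\sup|u|+[u]_\beta$, where $[u]_\beta$ is the least such $A$. Finally, $A\hookrightarrow B$ means that $A\subset B$ and $\|f\|_B\le C\|f\|_A$ for all $f\in A$, with $C$ independent of $f$. **Theorem.** Let $1<p<\infty$ and $\alpha>0$. (a) If $p<N/\alpha$, then $L^{\alpha,p}\hookrightarrow L^q$ for $p\le q\le p^*$, where $\frac1{p^*}=\frac1p-\frac\alpha N$. (b) If $p=N/\alpha$, then $L^{\alpha,p}\hookrightarrow L^q$ for $p\le q<\infty$. If in addition $\alpha<1$, then $L^{\alpha,p}\hookrightarrow BMO$. (c) If $p>N/\alpha$, then $L^{\alpha,p}\hookrightarrow L^q$ for $p\le q\le\infty$. If in addition $\alpha<1+N/p$, then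 $L^{\alpha,p}\hookrightarrow C^{\alpha-N/p}$. -/

import Mathlib

open MeasureTheory Set
open scoped ENNReal NNReal ContDiff

namespace AhlforsBessel

/-- `(X, d, μ)` is Ahlfors `N`-regular: `μ (B(x, r))` is comparable to `r ^ N`, uniformly in
`x ∈ X` and `0 < r < μ X`. -/
structure IsAhlforsRegular {X : Type*} [MetricSpace X] [MeasurableSpace X]
    (μ : Measure X) (N : ℝ) : Prop where
  dim_pos : 0 < N
  measure_ball : ∃ c C : ℝ, 0 < c ∧ 0 < C ∧ ∀ (x : X) (r : ℝ), 0 < r →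
    ENNReal.ofReal r < μ univ →
      ENNReal.ofReal (c * r ^ N) ≤ μ (Metric.ball x r) ∧
      μ (Metric.ball x r) ≤ ENNReal.ofReal (C * r ^ N)

/-- The profile `h : [0, ∞) → ℝ`: nonnegative, nonincreasing, `C^∞`, equal to `1` on `[0, 1/2]`
and to `0` on `[2, ∞)`. Values at negative numbers play no role. -/
structure IsCutoff (h : ℝ → ℝ) : Prop where
  nonneg : ∀ r, 0 ≤ r → 0 ≤ h r
  antitone : AntitoneOn h (Ici 0)
  smooth : ContDiffOn ℝ ∞ h (Ici 0)
  eq_one : ∀ r, 0 ≤ r → r ≤ 1 / 2 → h r = 1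
  eq_zero : ∀ r, 2 ≤ r → h r = 0

section Kernels

variable {X : Type*} [MetricSpace X] [MeasurableSpace X]

/-- `T_t f (x) = t^{-N} ∫ h(d(x,y)/t) f(y) dμ(y)`. -/
noncomputable def opT (μ : Measure X) (N : ℝ) (h : ℝ → ℝ) (t : ℝ) (f : X → ℝ) (x : X) : ℝ :=
  1 / t ^ N * ∫ y, h (dist x y / t) * f y ∂μ

/-- `φ(x,t) = 1 / T_t 1 (x)`. -/
noncomputable def phi (μ : Measure X) (N : ℝ) (h : ℝ → ℝ) (x : X) (t : ℝ) : ℝ :=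
  1 / opT μ N h t (fun _ => 1) x

/-- `ψ(x,t) = 1 / T_t (1 / T_t 1) (x)`. -/
noncomputable def psi (μ : Measure X) (N : ℝ) (h : ℝ → ℝ) (x : X) (t : ℝ) : ℝ :=
  1 / opT μ N h t (fun y => 1 / opT μ N h t (fun _ => 1) y) x

/-- The kernel `s(x,y,t)` of the Coifman-type approximation of the identity
`S_t = M_t T_t V_t T_t M_t`, where `M_t`, `V_t` are multiplication by `φ(·,t)`, `ψ(·,t)`. -/
noncomputable def kernelS (μ : Measure X) (N : ℝ) (h : ℝ → ℝ) (x y : X) (t : ℝ) : ℝ :=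
  phi μ N h x t * phi μ N h y t / t ^ (2 * N) *
    ∫ z, h (dist x z / t) * h (dist y z / t) * psi μ N h z t ∂μ

/-- The Bessel kernel `k_α(x,y) = α ∫_0^∞ t^α / (1 + t^α)^2 s(x,y,t) dt/t`.
(On the diagonal, a null set in an Ahlfors regular space, the integral may diverge.) -/
noncomputable def besselKernel (μ : Measure X) (N : ℝ) (h : ℝ → ℝ) (α : ℝ) (x y : X) : ℝ :=
  α * ∫ t in Ioi (0 : ℝ), t ^ α / (1 + t ^ α) ^ 2 * kernelS μ N h x y t / t

/-- The Bessel potential `J_α g (x) = ∫ g(z) k_α(x,z) dμ(z)`. -/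
noncomputable def besselPotential (μ : Measure X) (N : ℝ) (h : ℝ → ℝ) (α : ℝ)
    (g : X → ℝ) (x : X) : ℝ :=
  ∫ z, g z * besselKernel μ N h α x z ∂μ

end Kernels

/-- A space of real functions on `X`: which functions belong to it, and their (semi)norm.
In all the spaces below both depend only on the almost everywhere class of the function. -/
structure FunctionSpace (X : Type*) where
  mem : (X → ℝ) → Prop
  norm : (X → ℝ) → ℝ≥0∞

/-- `A ↪ B`: `A` is contained in `B` and the (linear) inclusion is bounded. -/
def FunctionSpace.Embeds {X : Type*} (A B : FunctionSpace X) : Prop :=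
  ∃ C : ℝ≥0, ∀ f : X → ℝ, A.mem f → B.mem f ∧ B.norm f ≤ C * A.norm f

section Spaces

variable {X : Type*} [MetricSpace X] [MeasurableSpace X]

/-- The Lebesgue space `L^q`. -/
noncomputable def lebesgueSpace (μ : Measure X) (q : ℝ≥0∞) : FunctionSpace X where
  mem f := MemLp f q μ
  norm f := eLpNorm f q μ

/-- The potential space `L^{α,p} = J_α (L^p)`, with norm
`‖f‖_p + inf {‖g‖_p : g ∈ L^p, J_α g = f}`. -/
noncomputable def potentialSpace (μ : Measure X) (N : ℝ) (h : ℝ → ℝ) (α : ℝ) (p : ℝ≥0∞) :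
    FunctionSpace X where
  mem f := MemLp f p μ ∧ ∃ g : X → ℝ, MemLp g p μ ∧ f =ᵐ[μ] besselPotential μ N h α g
  norm f := eLpNorm f p μ +
    ⨅ (g : X → ℝ) (_ : MemLp g p μ ∧ f =ᵐ[μ] besselPotential μ N h α g), eLpNorm g p μ

/-- `sup_B ⨍_B |f - f_B| dμ`, the supremum being over all balls `B`. -/
noncomputable def bmoSeminorm (μ : Measure X) (f : X → ℝ) : ℝ≥0∞ :=
  ⨆ (x : X) (r : ℝ) (_ : 0 < r),
    ⨍⁻ y in Metric.ball x r, ‖f y - ⨍ z in Metric.ball x r, f z ∂μ‖ₑ ∂μ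

/-- The space `BMO` of functions of bounded mean oscillation, with its usual seminorm
(which vanishes on constants). -/
noncomputable def bmoSpace (μ : Measure X) : FunctionSpace X where
  mem f := (∀ (x : X) (r : ℝ), 0 < r → IntegrableOn f (Metric.ball x r) μ) ∧ bmoSeminorm μ f < ⊤
  norm f := bmoSeminorm μ f

/-- The space `C^β` of bounded Lipschitz-`β` (Hölder) functions with norm `sup |u| + [u]_β`,
as a space of almost everywhere classes. -/
noncomputable def holderSpace (μ : Measure X) (β : ℝ≥0) : FunctionSpace X where
  mem f := ∃ u : X → ℝ, f =ᵐ[μ] u ∧ (⨆ x, ‖u x‖ₑ) < ⊤ ∧ MemHolder β u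
  norm f := ⨅ (u : X → ℝ) (_ : f =ᵐ[μ] u), (⨆ x, ‖u x‖ₑ) + eHolderNorm β u

end Spaces

end AhlforsBessel

namespace AhlforsBessel

/-! All the embeddings come from cutting the scale integral at some r. Write J_α g(x) as a double
integral of g(z) w(t) s(x,z,t), with w = `besselWeight`. Of s one needs only size t^(-N), support in
d(x,z) < 4t, and a Lipschitz bound in x with constant t^(-N-1) (`BallGrowth.exists_isScaleKernel`).
Hence the average of |g| against |s(x,·,t)| is controlled both by the maximal function Mg(x) and, by
Hölder's inequality, by t^(-N/p) ‖g‖_p. Also w(t) ≤ α t^(β-1) for every 0 ≤ β ≤ α.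

Lebesgue exponents p < q < ∞: with β = N(1/p - 1/q) ≤ α, scales below r contribute r^β Mg(x) and
scales above r contribute r^(β-N/p) ‖g‖_p, up to constants. The best r gives Hedberg's bound
Mg(x)^(p/q) ‖g‖_p^(1-p/q) (`IsScaleKernel.exists_potentialMajorant_le_hedberg`), and the L^p bound
for M finishes. That bound is proved from a Vitali covering.

If α > N/p, the Hölder estimate also converges at small scales, which gives boundedness. For the
difference of two values at distance at most 2r, the small scales are estimated separately, while
the large ones gain r/t from the Lipschitz bound and converge when α < 1 + N/p
(`IsScaleKernel.enorm_scalePotential_sub_le`). Taking r = d(x,x') gives Hölder continuity. If α =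
N/p, the large scales contribute a constant and the small ones r^α Mg, whose mean over a ball of
radius r is bounded by the L^p bound for M; this is the BMO estimate. -/

/-- Two-sided `N`-dimensional growth of balls of every radius, with explicit constants. -/
structure BallGrowth {X : Type*} [MetricSpace X] [MeasurableSpace X]
    (μ : Measure X) (N c C : ℝ) : Prop where
  dim_pos : 0 < N
  lower_pos : 0 < c
  upper_pos : 0 < C
  lower : ∀ (x : X) (r : ℝ), 0 < r → ENNReal.ofReal (c * r ^ N) ≤ μ (Metric.ball x r)
  upper : ∀ (x : X) (r : ℝ), 0 < r → μ (Metric.ball x r) ≤ ENNReal.ofReal (C * r ^ N)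

/-! ### Consequences of ball growth: σ-finiteness and separability. -/

section Geometry

variable {X : Type*} [MetricSpace X] [MeasurableSpace X] {μ : Measure X} {N c C : ℝ}

theorem IsAhlforsRegular.exists_ballGrowth (hreg : IsAhlforsRegular μ N) (hμ : μ univ = ⊤) :
    ∃ c C : ℝ, BallGrowth μ N c C := by
  obtain ⟨hN, c, C, hc, hC, H⟩ := hreg
  have htop : ∀ r : ℝ, ENNReal.ofReal r < μ univ := fun r => by simp [hμ]
  exact ⟨c, C, hN, hc, hC, fun x r hr => (H x r hr (htop r)).1,
    fun x r hr => (H x r hr (htop r)).2⟩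

namespace BallGrowth

theorem measure_ball_lt_top (H : BallGrowth μ N c C) (x : X) (r : ℝ) :
    μ (Metric.ball x r) < ⊤ := by
  rcases le_or_gt r 0 with hr | hr
  · simp [Metric.ball_eq_empty.2 hr]
  · exact (H.upper x r hr).trans_lt ENNReal.ofReal_lt_top

theorem measure_ball_pos (H : BallGrowth μ N c C) (x : X) {r : ℝ} (hr : 0 < r) :
    0 < μ (Metric.ball x r) :=
  lt_of_lt_of_le (ENNReal.ofReal_pos.2 (mul_pos H.lower_pos (Real.rpow_pos_of_pos hr N)))
    (H.lower x r hr)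

theorem measureReal_ball_le (H : BallGrowth μ N c C) (x : X) {r : ℝ} (hr : 0 < r) :
    μ.real (Metric.ball x r) ≤ C * r ^ N :=
  ENNReal.toReal_le_of_le_ofReal
    (mul_nonneg H.upper_pos.le (Real.rpow_nonneg hr.le N)) (H.upper x r hr)

theorem le_measureReal_ball (H : BallGrowth μ N c C) (x : X) {r : ℝ} (hr : 0 < r) :
    c * r ^ N ≤ μ.real (Metric.ball x r) :=
  (ENNReal.ofReal_le_iff_le_toReal (H.measure_ball_lt_top x r).ne).1 (H.lower x r hr)

theorem sigmaFinite (H : BallGrowth μ N c C) : SigmaFinite μ := by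
  rcases isEmpty_or_nonempty X with hX | ⟨⟨x⟩⟩
  · have : μ = 0 := Measure.eq_zero_of_isEmpty μ
    rw [this]; infer_instance
  · exact ⟨⟨{ set := fun n => Metric.ball x n
              set_mem := fun _ => trivial
              finite := fun n => H.measure_ball_lt_top x n
              spanning := Metric.iUnion_ball_nat x }⟩⟩

/-- A σ-finite measure cannot charge uncountably many disjoint sets, and every ball has positive
measure. -/
theorem countable_of_pairwiseDisjoint [OpensMeasurableSpace X] (H : BallGrowth μ N c C)
    {u : Set X} {r : X → ℝ} (hr : ∀ x ∈ u, 0 < r x)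
    (hu : u.PairwiseDisjoint fun x => Metric.closedBall x (r x)) : u.Countable := by
  have := H.sigmaFinite
  have h1 : Set.Countable {i : u | 0 < μ (Metric.ball (i : X) (r i))} := by
    refine Measure.countable_meas_pos_of_disjoint_iUnion
      (fun i => Metric.isOpen_ball.measurableSet) ?_
    intro i j hij
    exact (hu i.2 j.2 (fun h => hij (Subtype.ext h))).mono Metric.ball_subset_closedBall
      Metric.ball_subset_closedBall
  have h2 : {i : u | 0 < μ (Metric.ball (i : X) (r i))} = univ :=
    eq_univ_of_forall fun i => H.measure_ball_pos _ (hr _ i.2)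
  rw [h2, countable_univ_iff] at h1
  exact h1

/-- A Vitali subfamily of the balls of radius ε/4 is countable, and its centres form an ε-net.
Separability makes the distance jointly measurable, which the Tonelli arguments below require. -/
theorem secondCountableTopology [OpensMeasurableSpace X] (H : BallGrowth μ N c C) :
    SecondCountableTopology X := by
  refine Metric.secondCountable_of_almost_dense_set fun ε hε => ?_
  obtain ⟨u, -, hu, hcov⟩ := Vitali.exists_disjoint_subfamily_covering_enlargement_closedBall
    (univ : Set X) id (fun _ => ε / 4) (ε / 4) (fun _ _ => le_rfl) 4 (by norm_num)
  refine ⟨u, H.countable_of_pairwiseDisjoint (r := fun _ => ε / 4)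
    (fun _ _ => by positivity) hu, fun x => ?_⟩
  obtain ⟨b, hb, hsub⟩ := hcov x trivial
  refine ⟨b, hb, ?_⟩
  have := hsub (Metric.mem_closedBall_self (by positivity))
  simpa [Metric.mem_closedBall, mul_div_cancel₀] using this

end BallGrowth

end Geometry

/-! ### Lipschitz extension of the profile. -/

section Cutoff

/-- A cutoff profile extended to the whole line so as to be globally Lipschitz. -/
structure IsLipschitzCutoff (h : ℝ → ℝ) (L : ℝ) : Prop where
  nonneg : ∀ r, 0 ≤ h r
  le_one : ∀ r, h r ≤ 1
  eq_one : ∀ r, 0 ≤ r → r ≤ 1 / 2 → h r = 1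
  eq_zero : ∀ r, 2 ≤ r → h r = 0
  lipschitz : ∀ r r', |h r - h r'| ≤ L * |r - r'|

theorem IsLipschitzCutoff.continuous {h : ℝ → ℝ} {L : ℝ} (hh : IsLipschitzCutoff h L) :
    Continuous h := by
  refine (LipschitzWith.of_dist_le_mul (K := L.toNNReal) fun r r' => ?_).continuous
  simp only [Real.dist_eq]
  exact (hh.lipschitz r r').trans
    (mul_le_mul_of_nonneg_right (Real.le_coe_toNNReal L) (abs_nonneg _))

theorem IsLipschitzCutoff.const_nonneg {h : ℝ → ℝ} {L : ℝ} (hh : IsLipschitzCutoff h L) :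
    0 ≤ L := by
  simpa using (abs_nonneg _).trans (hh.lipschitz 1 0)

/-- The extension r ↦ h(min(|r|, 2)) inherits a Lipschitz constant from the C^1 function h on the
compact interval [0, 2], since the clamping map is 1-Lipschitz. -/
theorem IsCutoff.exists_isLipschitzCutoff {h : ℝ → ℝ} (hh : IsCutoff h) :
    ∃ (H : ℝ → ℝ) (L : ℝ), IsLipschitzCutoff H L ∧ ∀ r, 0 ≤ r → H r = h r := by
  obtain ⟨K, hK⟩ : ∃ K, LipschitzOnWith K h (Icc 0 2) :=
    ((hh.smooth.of_le (by exact_mod_cast le_top)).mono Icc_subset_Ici_self).exists_lipschitzOnWith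
      (n := 1) one_ne_zero (convex_Icc 0 2) isCompact_Icc
  have hmem : ∀ r : ℝ, min |r| 2 ∈ Icc (0 : ℝ) 2 := fun r =>
    ⟨le_min (abs_nonneg r) zero_le_two, min_le_right _ _⟩
  have heq : ∀ r, 0 ≤ r → h (min |r| 2) = h r := fun r hr => by
    rw [abs_of_nonneg hr]
    rcases le_total r 2 with h2 | h2
    · rw [min_eq_left h2]
    · rw [min_eq_right h2, hh.eq_zero 2 le_rfl, hh.eq_zero r h2]
  refine ⟨fun r => h (min |r| 2), K, ⟨fun r => hh.nonneg _ (hmem r).1, fun r => ?_,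
    fun r h0 h1 => ?_, fun r h2 => ?_, fun r r' => ?_⟩, heq⟩
  · rw [← hh.eq_one 0 le_rfl (by norm_num)]
    exact hh.antitone (mem_Ici.2 le_rfl) (mem_Ici.2 (hmem r).1) (hmem r).1
  · exact (heq r h0).trans (hh.eq_one r h0 h1)
  · exact (heq r (by linarith)).trans (hh.eq_zero r h2)
  · have h1 := hK.dist_le_mul _ (hmem r) _ (hmem r')
    rw [Real.dist_eq, Real.dist_eq] at h1
    refine h1.trans (mul_le_mul_of_nonneg_left ?_ K.2)
    refine (abs_min_sub_min_le_max _ _ _ _).trans ?_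
    simpa using abs_abs_sub_abs_le r r'

variable {X : Type*} [MetricSpace X] [MeasurableSpace X] {μ : Measure X} {N : ℝ}

theorem besselPotential_congr {h H : ℝ → ℝ} (hH : ∀ r, 0 ≤ r → H r = h r) (α : ℝ) :
    besselPotential μ N h α = besselPotential μ N H α := by
  have h0 : ∀ {t : ℝ}, 0 < t → ∀ x y : X, H (dist x y / t) = h (dist x y / t) :=
    fun ht x y => hH _ (div_nonneg dist_nonneg ht.le)
  have h1 : ∀ {t : ℝ}, 0 < t → ∀ x y : X,
      kernelS μ N H x y t = kernelS μ N h x y t := fun ht x y => by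
    simp only [kernelS, phi, psi, opT, h0 ht]
  have h2 : ∀ x y : X, besselKernel μ N h α x y = besselKernel μ N H α x y := fun x y => by
    unfold besselKernel
    congr 1
    refine setIntegral_congr_fun measurableSet_Ioi fun t ht => ?_
    simp only [h1 (mem_Ioi.1 ht)]
  funext g x
  simp only [besselPotential, h2]

end Cutoff

/-! ### Size, support and regularity of the kernel s. -/

section KernelEstimates

variable {X : Type*} [MetricSpace X] [MeasurableSpace X] {μ : Measure X} {N c C L : ℝ} {h : ℝ → ℝ}

theorem abs_integral_le_of_eq_zero_off {X : Type*} [MeasurableSpace X] {μ : Measure X}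
    {f : X → ℝ} {F : ℝ} {S : Set X} (hS : μ S < ⊤)
    (hf : ∀ y, |f y| ≤ F) (h0 : ∀ y, y ∉ S → f y = 0) : |∫ y, f y ∂μ| ≤ F * μ.real S := by
  rw [← setIntegral_eq_integral_of_forall_compl_eq_zero h0]
  exact norm_setIntegral_le_of_norm_le_const (f := f) hS fun y _ => (Real.norm_eq_abs _).trans_le (hf y)

theorem integrable_of_eq_zero_off {X : Type*} [MeasurableSpace X] {μ : Measure X}
    {f : X → ℝ} {F : ℝ} {S : Set X} (hS : μ S < ⊤)
    (hm : AEStronglyMeasurable f μ) (hf : ∀ y, |f y| ≤ F) (h0 : ∀ y, y ∉ S → f y = 0) :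
    Integrable f μ := by
  rw [← integrableOn_iff_integrable_of_support_subset
    (s := S) (fun y hy => by by_contra hn; exact hy (h0 y hn))]
  exact Measure.integrableOn_of_bounded hS.ne hm (ae_of_all _ hf)

namespace IsLipschitzCutoff

theorem apply_eq_zero {X : Type*} [MetricSpace X] (hh : IsLipschitzCutoff h L) {x y : X} {t : ℝ} (ht : 0 < t)
    (hy : y ∉ Metric.ball x (2 * t)) : h (dist x y / t) = 0 := by
  rw [Metric.mem_ball, dist_comm, not_lt] at hy
  exact hh.eq_zero _ ((le_div_iff₀ ht).2 hy)

theorem abs_le_one (hh : IsLipschitzCutoff h L) (r : ℝ) : |h r| ≤ 1 :=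
  abs_le.2 ⟨by linarith [hh.nonneg r], hh.le_one r⟩

theorem abs_sub_le {X : Type*} [MetricSpace X] (hh : IsLipschitzCutoff h L) (x x' y : X) {t : ℝ} (ht : 0 < t) :
    |h (dist x y / t) - h (dist x' y / t)| ≤ L * (dist x x' / t) := by
  refine (hh.lipschitz _ _).trans (mul_le_mul_of_nonneg_left ?_ hh.const_nonneg)
  rw [← sub_div, abs_div, abs_of_pos ht]
  exact div_le_div_of_nonneg_right (abs_dist_sub_le x x' y) ht.le

variable [OpensMeasurableSpace X] [SecondCountableTopology X]

theorem measurable_comp_dist (hh : IsLipschitzCutoff h L) {β : Type*} [MeasurableSpace β]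
    {u v : β → X} {t : β → ℝ} (hu : Measurable u) (hv : Measurable v) (ht : Measurable t) :
    Measurable fun b => h (dist (u b) (v b) / t b) :=
  hh.continuous.measurable.comp ((hu.dist hv).div ht)

end IsLipschitzCutoff

theorem BallGrowth.measureReal_ball_two_mul_le (H : BallGrowth μ N c C) (x : X) {t : ℝ} (ht : 0 < t) :
    μ.real (Metric.ball x (2 * t)) ≤ C * 2 ^ N * t ^ N := by
  have := H.measureReal_ball_le x (r := 2 * t) (by positivity)
  rwa [Real.mul_rpow zero_le_two ht.le, ← mul_assoc] at this

variable [OpensMeasurableSpace X] [SecondCountableTopology X]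

namespace BallGrowth

/-- From below, keep only B(x, t/2), where h = 1; from above, use h ≤ 1 and the support in B(x, 2t).
Regularity turns both measures into multiples of t^N. -/
theorem opT_bounds (H : BallGrowth μ N c C) (hh : IsLipschitzCutoff h L) {f : X → ℝ} {m F t : ℝ}
    (hm0 : 0 ≤ m) (hf : Measurable f) (hm : ∀ y, m ≤ f y) (hF : ∀ y, f y ≤ F) (ht : 0 < t)
    (x : X) : m * (c / 2 ^ N) ≤ opT μ N h t f x ∧ opT μ N h t f x ≤ F * (C * 2 ^ N) := by
  have htN : 0 < t ^ N := Real.rpow_pos_of_pos ht N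
  have hF0 : 0 ≤ F := hm0.trans ((hm x).trans (hF x))
  have hb : ∀ y, |h (dist x y / t) * f y| ≤ F := fun y => by
    rw [abs_mul, abs_of_nonneg (hm0.trans (hm y))]
    exact (mul_le_mul (hh.abs_le_one _) (hF y) (hm0.trans (hm y)) zero_le_one).trans
      (one_mul F).le
  have hz : ∀ y, y ∉ Metric.ball x (2 * t) → h (dist x y / t) * f y = 0 := fun y hy => by
    rw [hh.apply_eq_zero ht hy, zero_mul]
  have hint : Integrable (fun y => h (dist x y / t) * f y) μ :=
    integrable_of_eq_zero_off (H.measure_ball_lt_top _ _)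
      ((hh.measurable_comp_dist measurable_const measurable_id measurable_const).mul
        hf).aestronglyMeasurable hb hz
  unfold opT
  rw [one_div, ← div_eq_inv_mul, le_div_iff₀ htN, div_le_iff₀ htN]
  constructor
  · have h1 : m * μ.real (Metric.ball x (t / 2))
        ≤ ∫ y in Metric.ball x (t / 2), h (dist x y / t) * f y ∂μ := by
      rw [mul_comm, ← smul_eq_mul, ← setIntegral_const]
      refine setIntegral_mono_on (integrableOn_const (H.measure_ball_lt_top _ _).ne)
        hint.integrableOn Metric.isOpen_ball.measurableSet fun y hy => ?_
      rw [Metric.mem_ball, dist_comm] at hy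
      rw [hh.eq_one _ (div_nonneg dist_nonneg ht.le)
        ((div_le_iff₀ ht).2 (by linarith)), one_mul]
      exact hm y
    have h2 := setIntegral_le_integral (s := Metric.ball x (t / 2)) hint
      (ae_of_all _ fun y => mul_nonneg (hh.nonneg _) (hm0.trans (hm y)))
    refine le_trans ?_ (h1.trans h2)
    rw [mul_assoc]
    refine mul_le_mul_of_nonneg_left (le_trans (le_of_eq ?_)
      (H.le_measureReal_ball x (half_pos ht))) hm0
    rw [Real.div_rpow ht.le zero_le_two]
    ring
  · refine (le_abs_self _).trans
      ((abs_integral_le_of_eq_zero_off (H.measure_ball_lt_top _ _) hb hz).trans ?_)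
    rw [mul_assoc]
    exact mul_le_mul_of_nonneg_left (H.measureReal_ball_two_mul_le x ht) hF0

theorem opT_one_bounds (H : BallGrowth μ N c C) (hh : IsLipschitzCutoff h L) {t : ℝ} (ht : 0 < t)
    (x : X) : c / 2 ^ N ≤ opT μ N h t (fun _ => 1) x ∧
      opT μ N h t (fun _ => 1) x ≤ C * 2 ^ N := by
  simpa using H.opT_bounds hh zero_le_one measurable_const (fun _ => le_rfl) (fun _ => le_rfl) ht x

end BallGrowth

variable [SFinite μ]

theorem measurable_opT (hh : IsLipschitzCutoff h L) {f : ℝ → X → ℝ}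
    (hf : Measurable fun q : ℝ × X => f q.1 q.2) :
    Measurable fun q : X × ℝ => opT μ N h q.2 (f q.2) q.1 := by
  unfold opT
  refine (measurable_const.div (measurable_snd.pow_const N)).mul ?_
  refine StronglyMeasurable.measurable (StronglyMeasurable.integral_prod_right
    (f := fun (q : X × ℝ) y => h (dist q.1 y / q.2) * f q.2 y) (Measurable.stronglyMeasurable ?_))
  refine (hh.measurable_comp_dist (measurable_fst.comp measurable_fst) measurable_snd
    (measurable_snd.comp measurable_fst)).mul ?_
  exact hf.comp ((measurable_snd.comp measurable_fst).prodMk measurable_snd)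

theorem measurable_phi (hh : IsLipschitzCutoff h L) :
    Measurable fun q : X × ℝ => phi μ N h q.1 q.2 :=
  measurable_const.div (measurable_opT hh (f := fun _ _ => 1) measurable_const)

theorem measurable_psi (hh : IsLipschitzCutoff h L) :
    Measurable fun q : X × ℝ => psi μ N h q.1 q.2 :=
  measurable_const.div (measurable_opT hh
    (f := fun t y => 1 / opT μ N h t (fun _ => 1) y)
    ((measurable_phi hh).comp measurable_swap))

theorem measurable_kernelS (hh : IsLipschitzCutoff h L) (x : X) :
    Measurable fun q : X × ℝ => kernelS μ N h x q.1 q.2 := by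
  unfold kernelS
  refine Measurable.mul (Measurable.div (Measurable.mul ?_ (measurable_phi hh))
    (measurable_snd.pow_const _)) ?_
  · exact (measurable_phi hh).comp (measurable_const.prodMk measurable_snd)
  · refine StronglyMeasurable.measurable (StronglyMeasurable.integral_prod_right
      (f := fun (q : X × ℝ) z => h (dist x z / q.2) * h (dist q.1 z / q.2) * psi μ N h z q.2)
      (Measurable.stronglyMeasurable ?_))
    have ht : Measurable fun q : (X × ℝ) × X => q.1.2 := measurable_snd.comp measurable_fst
    refine ((hh.measurable_comp_dist measurable_const measurable_snd ht).mul
      (hh.measurable_comp_dist (measurable_fst.comp measurable_fst) measurable_snd ht)).mul ?_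
    exact (measurable_psi hh).comp (measurable_snd.prodMk ht)

/-- The properties of the approximation of the identity that the potential estimates use. -/
structure IsScaleKernel (N K : ℝ) (s : X → X → ℝ → ℝ) : Prop where
  const_nonneg : 0 ≤ K
  measurable : ∀ x, Measurable fun q : X × ℝ => s x q.1 q.2
  bound : ∀ x z t, 0 < t → |s x z t| ≤ K * t ^ (-N)
  eq_zero : ∀ x z t, 0 < t → z ∉ Metric.ball x (4 * t) → s x z t = 0
  lipschitz : ∀ x x' z t, 0 < t →
    |s x z t - s x' z t| ≤ K * t ^ (-N) * (dist x x' / t)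

set_option maxHeartbeats 2000000 in
-- Since T_t 1 lies between two positive constants a and b, φ and ψ are bounded, and the z-integral
-- is O(t^N); the prefactor t^(-2N) leaves t^(-N). Regularity is asked in x alone, so ψ needs bounds
-- but no continuity.
theorem BallGrowth.exists_isScaleKernel (H : BallGrowth μ N c C) (hh : IsLipschitzCutoff h L) :
    ∃ K, IsScaleKernel N K (kernelS μ N h : X → X → ℝ → ℝ) := by
  have hL := hh.const_nonneg
  have h2N : (0 : ℝ) < 2 ^ N := Real.rpow_pos_of_pos two_pos N
  set a : ℝ := c / 2 ^ N with ha_def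
  set b : ℝ := C * 2 ^ N with hb_def
  have ha : 0 < a := div_pos H.lower_pos h2N
  have hb : 0 < b := mul_pos H.upper_pos h2N
  have T1 : ∀ {t : ℝ}, 0 < t → ∀ x : X, a ≤ opT μ N h t (fun _ => 1) x ∧
      opT μ N h t (fun _ => 1) x ≤ b := fun ht x => H.opT_one_bounds hh ht x
  have T1pos : ∀ {t : ℝ}, 0 < t → ∀ x : X, 0 < opT μ N h t (fun _ => 1) x :=
    fun ht x => ha.trans_le (T1 ht x).1
  have phi_pos : ∀ {t : ℝ}, 0 < t → ∀ x : X, 0 < phi μ N h x t := fun ht x =>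
    one_div_pos.2 (T1pos ht x)
  have phi_le : ∀ {t : ℝ}, 0 < t → ∀ x : X, phi μ N h x t ≤ 1 / a := fun ht x =>
    one_div_le_one_div_of_le ha (T1 ht x).1
  have psi_pos_le : ∀ {t : ℝ}, 0 < t → ∀ x : X, 0 ≤ psi μ N h x t ∧ psi μ N h x t ≤ b / a := by
    intro t ht x
    have := (H.opT_bounds hh (m := 1 / b) (F := 1 / a) (f := fun y => phi μ N h y t) (by positivity)
      ((measurable_phi hh).comp (measurable_id.prodMk measurable_const))
      (fun y => one_div_le_one_div_of_le (T1pos ht y) (T1 ht y).2) (phi_le ht) ht x).1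
    rw [← ha_def] at this
    have h0 : 0 < 1 / b * a := by positivity
    refine ⟨one_div_nonneg.2 (h0.le.trans this), ?_⟩
    refine (one_div_le_one_div_of_le h0 this).trans (le_of_eq ?_)
    field_simp
  have meas_ball : ∀ {t : ℝ}, 0 < t → ∀ x : X, μ.real (Metric.ball x (2 * t)) ≤ b * t ^ N :=
    fun ht x => H.measureReal_ball_two_mul_le x ht
  set I : X → X → ℝ → ℝ := fun x y t =>
    ∫ z, h (dist x z / t) * h (dist y z / t) * psi μ N h z t ∂μ with hI
  have I_bound : ∀ {t : ℝ}, 0 < t → ∀ x y : X, |I x y t| ≤ b / a * (b * t ^ N) := by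
    intro t ht x y
    refine (abs_integral_le_of_eq_zero_off (F := b / a) (H.measure_ball_lt_top x (2 * t)) ?_ ?_).trans
      (mul_le_mul_of_nonneg_left (meas_ball ht x) (by positivity))
    · intro z
      rw [abs_mul, abs_mul, abs_of_nonneg (psi_pos_le ht z).1]
      refine (mul_le_mul (mul_le_one₀ (hh.abs_le_one _) (abs_nonneg _) (hh.abs_le_one _))
        (psi_pos_le ht z).2 (psi_pos_le ht z).1 zero_le_one).trans (one_mul _).le
    · intro z hz
      rw [hh.apply_eq_zero ht hz, zero_mul, zero_mul]
  have I_int : ∀ {t : ℝ}, 0 < t → ∀ x y : X,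
      Integrable (fun z => h (dist x z / t) * h (dist y z / t) * psi μ N h z t) μ := by
    intro t ht x y
    refine integrable_of_eq_zero_off (F := b / a) (H.measure_ball_lt_top x (2 * t))
      (Measurable.aestronglyMeasurable ?_) ?_ ?_
    · exact ((hh.measurable_comp_dist measurable_const measurable_id measurable_const).mul
        (hh.measurable_comp_dist measurable_const measurable_id measurable_const)).mul
        ((measurable_psi hh).comp (measurable_id.prodMk measurable_const))
    · intro z
      rw [abs_mul, abs_mul, abs_of_nonneg (psi_pos_le ht z).1]
      refine (mul_le_mul (mul_le_one₀ (hh.abs_le_one _) (abs_nonneg _) (hh.abs_le_one _))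
        (psi_pos_le ht z).2 (psi_pos_le ht z).1 zero_le_one).trans (one_mul _).le
    · intro z hz
      rw [hh.apply_eq_zero ht hz, zero_mul, zero_mul]
  have I_lip : ∀ {t : ℝ}, 0 < t → ∀ x x' y : X,
      |I x y t - I x' y t| ≤ L * (dist x x' / t) * (b / a) * (b * t ^ N) := by
    intro t ht x x' y
    have hd : 0 ≤ dist x x' / t := div_nonneg dist_nonneg ht.le
    rw [hI, ← integral_sub (I_int ht x y) (I_int ht x' y)]
    -- The common factor h(d(y,z)/t) confines both integrands to one ball about y, so x and x' may
    -- be far apart.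
    refine (abs_integral_le_of_eq_zero_off (F := L * (dist x x' / t) * (b / a))
      (H.measure_ball_lt_top y (2 * t)) ?_ ?_).trans
      (mul_le_mul_of_nonneg_left (meas_ball ht y) (by positivity))
    · intro z
      rw [show h (dist x z / t) * h (dist y z / t) * psi μ N h z t
        - h (dist x' z / t) * h (dist y z / t) * psi μ N h z t
        = (h (dist x z / t) - h (dist x' z / t)) * h (dist y z / t) * psi μ N h z t by ring,
        abs_mul, abs_mul, abs_of_nonneg (psi_pos_le ht z).1]
      refine mul_le_mul ?_ (psi_pos_le ht z).2 (psi_pos_le ht z).1 (by positivity)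
      exact (mul_le_mul (hh.abs_sub_le x x' z ht) (hh.abs_le_one _) (abs_nonneg _)
        (by positivity)).trans (mul_one _).le
    · intro z hz
      rw [hh.apply_eq_zero ht hz]
      ring
  have T1_int : ∀ {t : ℝ}, 0 < t → ∀ x : X, Integrable (fun z => h (dist x z / t) * 1) μ := by
    intro t ht x
    refine integrable_of_eq_zero_off (F := 1) (H.measure_ball_lt_top x (2 * t))
      (Measurable.aestronglyMeasurable ?_) (fun z => by rw [mul_one]; exact hh.abs_le_one _)
      (fun z hz => by rw [hh.apply_eq_zero ht hz, zero_mul])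
    exact (hh.measurable_comp_dist measurable_const measurable_id measurable_const).mul
      measurable_const
  have T1_lip : ∀ {t : ℝ}, 0 < t → ∀ x x' : X,
      |opT μ N h t (fun _ => 1) x - opT μ N h t (fun _ => 1) x'| ≤ L * (dist x x' / t) * (2 * b) := by
    intro t ht x x'
    have htN : 0 < t ^ N := Real.rpow_pos_of_pos ht N
    have hd : 0 ≤ dist x x' / t := div_nonneg dist_nonneg ht.le
    unfold opT
    rw [← mul_sub, ← integral_sub (T1_int ht x) (T1_int ht x'), abs_mul,
      abs_of_pos (one_div_pos.2 htN), one_div, ← div_eq_inv_mul, div_le_iff₀ htN]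
    refine (abs_integral_le_of_eq_zero_off (F := L * (dist x x' / t))
      (S := Metric.ball x (2 * t) ∪ Metric.ball x' (2 * t))
      (measure_union_lt_top (H.measure_ball_lt_top _ _) (H.measure_ball_lt_top _ _)) ?_ ?_).trans ?_
    · intro z
      rw [mul_one, mul_one]
      exact hh.abs_sub_le x x' z ht
    · intro z hz
      rw [mem_union, not_or] at hz
      rw [hh.apply_eq_zero ht hz.1, hh.apply_eq_zero ht hz.2, sub_self]
    · rw [mul_assoc _ (2 * b)]
      refine mul_le_mul_of_nonneg_left ((measureReal_union_le _ _).trans ?_) (by positivity)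
      linarith [meas_ball ht x, meas_ball ht x']
  have phi_lip : ∀ {t : ℝ}, 0 < t → ∀ x x' : X,
      |phi μ N h x t - phi μ N h x' t| ≤ L * (dist x x' / t) * (2 * b) / a ^ 2 := by
    intro t ht x x'
    have hd : 0 ≤ dist x x' / t := div_nonneg dist_nonneg ht.le
    unfold phi
    rw [div_sub_div _ _ (T1pos ht x).ne' (T1pos ht x').ne', one_mul, mul_one, abs_div,
      abs_of_pos (mul_pos (T1pos ht x) (T1pos ht x')), abs_sub_comm]
    refine div_le_div₀ (by positivity) (T1_lip ht x x') (by positivity) ?_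
    rw [sq]
    exact mul_le_mul (T1 ht x).1 (T1 ht x').1 ha.le (T1pos ht x).le
  have pow_eq : ∀ {t : ℝ}, 0 < t → t ^ (-N) = t ^ N / t ^ (2 * N) := fun ht => by
    rw [← Real.rpow_sub ht]; congr 1; ring
  -- One constant serves both bounds: the first summand is the size constant, the rest is the
  -- Lipschitz constant.
  refine ⟨b ^ 2 / a ^ 3 + (2 * L * b ^ 3 / a ^ 4 + L * b ^ 2 / a ^ 3), by positivity,
    measurable_kernelS hh, ?_, ?_, ?_⟩
  · intro x z t ht
    have ht2 : 0 < t ^ (2 * N) := Real.rpow_pos_of_pos ht _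
    have htN : 0 < t ^ N := Real.rpow_pos_of_pos ht _
    have h1 : |kernelS μ N h x z t| ≤ 1 / a * (1 / a) / t ^ (2 * N) * (b / a * (b * t ^ N)) := by
      unfold kernelS
      rw [abs_mul, abs_of_nonneg
        (div_nonneg (mul_nonneg (phi_pos ht x).le (phi_pos ht z).le) ht2.le)]
      refine mul_le_mul ?_ (I_bound ht x z) (abs_nonneg _) (by positivity)
      exact div_le_div_of_nonneg_right
        (mul_le_mul (phi_le ht x) (phi_le ht z) (phi_pos ht z).le (by positivity)) ht2.le
    refine h1.trans ?_
    rw [show 1 / a * (1 / a) / t ^ (2 * N) * (b / a * (b * t ^ N))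
      = b ^ 2 / a ^ 3 * (t ^ N / t ^ (2 * N)) by field_simp, pow_eq ht]
    exact mul_le_mul_of_nonneg_right (le_add_of_nonneg_right (by positivity)) (by positivity)
  · intro x z t ht hz
    unfold kernelS
    rw [Metric.mem_ball, not_lt, dist_comm] at hz
    rw [integral_eq_zero_of_ae (ae_of_all _ fun w => ?_), mul_zero]
    by_cases hw : w ∈ Metric.ball x (2 * t)
    · have : w ∉ Metric.ball z (2 * t) := by
        rw [Metric.mem_ball, dist_comm] at hw
        rw [Metric.mem_ball, not_lt]
        linarith [dist_triangle x w z]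
      simp [hh.apply_eq_zero ht this]
    · simp [hh.apply_eq_zero ht hw]
  · intro x x' z t ht
    have ht2 : 0 < t ^ (2 * N) := Real.rpow_pos_of_pos ht _
    have htN : 0 < t ^ N := Real.rpow_pos_of_pos ht _
    have hd : 0 ≤ dist x x' / t := div_nonneg dist_nonneg ht.le
    -- Product rule for differences: vary φ first, then the integral.
    have h1 : kernelS μ N h x z t - kernelS μ N h x' z t = phi μ N h z t / t ^ (2 * N) *
        ((phi μ N h x t - phi μ N h x' t) * I x z t
          + phi μ N h x' t * (I x z t - I x' z t)) := by
      simp only [kernelS, hI]; ring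
    have h2 : |kernelS μ N h x z t - kernelS μ N h x' z t| ≤ 1 / a / t ^ (2 * N) *
        (L * (dist x x' / t) * (2 * b) / a ^ 2 * (b / a * (b * t ^ N))
          + 1 / a * (L * (dist x x' / t) * (b / a) * (b * t ^ N))) := by
      rw [h1, abs_mul, abs_of_nonneg (div_nonneg (phi_pos ht z).le ht2.le)]
      refine mul_le_mul (div_le_div_of_nonneg_right (phi_le ht z) ht2.le) ?_ (abs_nonneg _)
        (by positivity)
      refine (abs_add_le _ _).trans (add_le_add ?_ ?_)
      · rw [abs_mul]
        exact mul_le_mul (phi_lip ht x x') (I_bound ht x z) (abs_nonneg _) (by positivity)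
      · rw [abs_mul, abs_of_pos (phi_pos ht x')]
        exact mul_le_mul (phi_le ht x') (I_lip ht x x' z) (abs_nonneg _) (by positivity)
    refine h2.trans ?_
    rw [show 1 / a / t ^ (2 * N) *
        (L * (dist x x' / t) * (2 * b) / a ^ 2 * (b / a * (b * t ^ N))
          + 1 / a * (L * (dist x x' / t) * (b / a) * (b * t ^ N)))
      = (2 * L * b ^ 3 / a ^ 4 + L * b ^ 2 / a ^ 3) * (t ^ N / t ^ (2 * N)) * (dist x x' / t) by
        field_simp, pow_eq ht]
    refine mul_le_mul_of_nonneg_right (mul_le_mul_of_nonneg_right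
      (le_add_of_nonneg_left (by positivity)) (by positivity)) hd

end KernelEstimates

/-! ### Integrals of powers and the layer-cake formula. -/

section PowerIntegrals

theorem lintegral_Ioc_rpow {s r : ℝ} (hs : 0 < s) (hr : 0 ≤ r) :
    ∫⁻ t in Ioc 0 r, ENNReal.ofReal (t ^ (s - 1)) = ENNReal.ofReal (r ^ s / s) := by
  have hi : IntervalIntegrable (fun t : ℝ => t ^ (s - 1)) volume 0 r :=
    intervalIntegral.intervalIntegrable_rpow' (by linarith)
  rw [← ofReal_integral_eq_lintegral_ofReal]
  · rw [← intervalIntegral.integral_of_le hr, integral_rpow (Or.inl (by linarith))]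
    simp [Real.zero_rpow hs.ne']
  · exact (intervalIntegrable_iff_integrableOn_Ioc_of_le hr).1 hi
  · filter_upwards [ae_restrict_mem measurableSet_Ioc] with t ht
    exact Real.rpow_nonneg ht.1.le _

theorem lintegral_Ioi_rpow_neg {s r : ℝ} (hs : 0 < s) (hr : 0 < r) :
    ∫⁻ t in Ioi r, ENNReal.ofReal (t ^ (-s - 1)) = ENNReal.ofReal (r ^ (-s) / s) := by
  rw [← ofReal_integral_eq_lintegral_ofReal]
  · rw [integral_Ioi_rpow_of_lt (by linarith) hr]
    congr 1
    rw [sub_add_cancel, div_neg, neg_div, neg_neg]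
  · exact integrableOn_Ioi_rpow_of_lt (by linarith) hr
  · filter_upwards [ae_restrict_mem measurableSet_Ioi] with t ht
    exact Real.rpow_nonneg (hr.trans ht).le _

/-- The layer-cake identity for a single value. The value ∞ is allowed because maximal functions may
take it. -/
theorem lintegral_layer {s : ℝ} (hs : 0 < s) (a : ℝ≥0∞) :
    ∫⁻ t in Ioi (0 : ℝ), (if ENNReal.ofReal t < a then ENNReal.ofReal (s * t ^ (s - 1)) else 0)
      = a ^ s := by
  have key : ∀ r : ℝ, 0 ≤ r →
      ∫⁻ t in Ioo 0 r, ENNReal.ofReal (s * t ^ (s - 1)) = ENNReal.ofReal r ^ s := by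
    intro r hr
    rw [setLIntegral_congr Ioo_ae_eq_Ioc]
    simp_rw [ENNReal.ofReal_mul hs.le]
    rw [lintegral_const_mul' _ _ ENNReal.ofReal_ne_top, lintegral_Ioc_rpow hs hr,
      ← ENNReal.ofReal_mul hs.le, mul_div_cancel₀ _ hs.ne', ENNReal.ofReal_rpow_of_nonneg hr hs.le]
  have hind : ∀ b : ℝ≥0∞, ∫⁻ t in Ioi (0 : ℝ),
      (if ENNReal.ofReal t < b then ENNReal.ofReal (s * t ^ (s - 1)) else 0)
      = ∫⁻ t in {t : ℝ | ENNReal.ofReal t < b} ∩ Ioi 0, ENNReal.ofReal (s * t ^ (s - 1)) := by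
    intro b
    have hm : MeasurableSet {t : ℝ | ENNReal.ofReal t < b} :=
      measurableSet_lt ENNReal.measurable_ofReal measurable_const
    rw [← setLIntegral_indicator hm]
    refine lintegral_congr fun t => ?_
    by_cases hb : ENNReal.ofReal t < b <;> simp [hb]
  have hfin : ∀ r : ℝ, 0 ≤ r → {t : ℝ | ENNReal.ofReal t < ENNReal.ofReal r} ∩ Ioi 0 = Ioo 0 r := by
    intro r hr
    ext t
    simp only [mem_inter_iff, mem_ofPred_eq, mem_Ioi, mem_Ioo]
    constructor
    · rintro ⟨h1, h2⟩
      exact ⟨h2, ((ENNReal.ofReal_lt_ofReal_iff_of_nonneg h2.le).1 h1)⟩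
    · rintro ⟨h1, h2⟩
      exact ⟨(ENNReal.ofReal_lt_ofReal_iff_of_nonneg h1.le).2 h2, h1⟩
  rw [hind]
  rcases eq_or_ne a ⊤ with rfl | ha
  · rw [ENNReal.top_rpow_of_pos hs]
    -- Integrating only up to q^(1/s) already yields q.
    refine ENNReal.eq_top_of_forall_nnreal_le fun q => ?_
    have h1 := key ((q : ℝ) ^ (1 / s)) (by positivity)
    rw [ENNReal.ofReal_rpow_of_nonneg (by positivity) hs.le, ← Real.rpow_mul (NNReal.coe_nonneg q),
      one_div_mul_cancel hs.ne', Real.rpow_one, ENNReal.ofReal_coe_nnreal] at h1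
    rw [← h1]
    exact lintegral_mono_set fun t ht => ⟨by simp, ht.1⟩
  · obtain ⟨r, hr, rfl⟩ : ∃ r : ℝ, 0 ≤ r ∧ a = ENNReal.ofReal r :=
      ⟨a.toReal, ENNReal.toReal_nonneg, (ENNReal.ofReal_toReal ha).symm⟩
    rw [hfin r hr, key r hr]

end PowerIntegrals

/-! ### The maximal theorem. -/

section Maximal

variable {X : Type*} [MetricSpace X] [MeasurableSpace X] {μ : Measure X} {N c C : ℝ}

/-- The Hardy–Littlewood maximal function, normalised by `r ^ N` instead of `μ (B(x, r))`, and with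
rational radii. -/
noncomputable def maximalFunction (μ : Measure X) (N : ℝ) (f : X → ℝ≥0∞) (x : X) : ℝ≥0∞ :=
  ⨆ (r : ℚ) (_ : 0 < r), ENNReal.ofReal ((r : ℝ) ^ (-N)) * ∫⁻ z in Metric.ball x r, f z ∂μ

theorem maximalFunction_congr {f g : X → ℝ≥0∞} (hfg : f =ᵐ[μ] g) :
    maximalFunction μ N f = maximalFunction μ N g := by
  funext x
  unfold maximalFunction
  simp_rw [lintegral_congr_ae (ae_restrict_of_ae hfg)]

theorem measurable_lintegral_ball [OpensMeasurableSpace X] [SecondCountableTopology X] [SFinite μ]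
    {f : X → ℝ≥0∞} (hf : Measurable f) (r : ℝ) :
    Measurable fun x => ∫⁻ z in Metric.ball x r, f z ∂μ := by
  have hS : MeasurableSet {q : X × X | dist q.2 q.1 < r} :=
    measurableSet_lt (measurable_snd.dist measurable_fst) measurable_const
  have := Measurable.lintegral_prod_right' (ν := μ) ((hf.comp measurable_snd).indicator hS)
  convert! this using 2 with x
  rw [← lintegral_indicator Metric.isOpen_ball.measurableSet]
  rfl

theorem measurable_maximalFunction [OpensMeasurableSpace X] [SecondCountableTopology X] [SFinite μ]
    {f : X → ℝ≥0∞} (hf : Measurable f) : Measurable (maximalFunction μ N f) :=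
  Measurable.iSup fun r => Measurable.iSup fun _ =>
    (measurable_lintegral_ball hf r).const_mul _

/-- Rational radii make the supremum countable, hence measurable. A rational between r and 2r
recovers real radii at the price of 2^N. -/
theorem le_maximalFunction (hN : 0 < N) (f : X → ℝ≥0∞) (x : X) {r : ℝ} (hr : 0 < r) :
    ENNReal.ofReal (r ^ (-N)) * ∫⁻ z in Metric.ball x r, f z ∂μ
      ≤ ENNReal.ofReal (2 ^ N) * maximalFunction μ N f x := by
  obtain ⟨q, hq1, hq2⟩ := exists_rat_btwn (show r < 2 * r by linarith)
  have hq0 : (0 : ℝ) < q := hr.trans hq1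
  have h1 : r ^ (-N) ≤ 2 ^ N * (q : ℝ) ^ (-N) := by
    rw [Real.rpow_neg hr.le, Real.rpow_neg hq0.le, ← div_eq_mul_inv, inv_eq_one_div,
      div_le_div_iff₀ (by positivity) (by positivity), one_mul,
      ← Real.mul_rpow zero_le_two hr.le]
    exact Real.rpow_le_rpow hq0.le hq2.le hN.le
  calc ENNReal.ofReal (r ^ (-N)) * ∫⁻ z in Metric.ball x r, f z ∂μ
      ≤ ENNReal.ofReal (2 ^ N * (q : ℝ) ^ (-N)) * ∫⁻ z in Metric.ball x q, f z ∂μ :=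
        mul_le_mul' (ENNReal.ofReal_le_ofReal h1)
          (lintegral_mono_set (Metric.ball_subset_ball hq1.le))
    _ ≤ _ := by
        rw [ENNReal.ofReal_mul (by positivity), mul_assoc]
        refine mul_le_mul_right ?_ _
        exact le_iSup₂ (f := fun (r : ℚ) (_ : 0 < r) =>
          ENNReal.ofReal ((r : ℝ) ^ (-N)) * ∫⁻ z in Metric.ball x r, f z ∂μ) q
          (by exact_mod_cast hq0)

namespace BallGrowth

/-- Vitali covering: each point of the level set is the centre of a ball on which f has integral at
least λ r^N. A disjoint subfamily whose enlargements cover the set has total mass at most ∫ f. -/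
theorem measure_lt_maximalFunction_le [OpensMeasurableSpace X] (H : BallGrowth μ N c C)
    (f : X → ℝ≥0∞) {lam : ℝ≥0∞} (h0 : lam ≠ 0) (htop : lam ≠ ⊤) :
    μ {x | lam < maximalFunction μ N f x} ≤ ENNReal.ofReal (C * 6 ^ N) / lam * ∫⁻ z, f z ∂μ := by
  have hN := H.dim_pos
  have hC := H.upper_pos
  have hK : ENNReal.ofReal (C * 6 ^ N) / lam ≠ 0 :=
    ENNReal.div_ne_zero.2 ⟨(ENNReal.ofReal_pos.2 (by positivity)).ne', htop⟩
  rcases eq_or_ne (∫⁻ z, f z ∂μ) ⊤ with hf | hf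
  · rw [hf, ENNReal.mul_top hK]; exact le_top
  have hex : ∀ x, ∃ r : ℝ, lam < maximalFunction μ N f x → 0 < r ∧
      lam * ENNReal.ofReal (r ^ N) ≤ ∫⁻ z in Metric.ball x r, f z ∂μ := by
    intro x
    by_cases hx : lam < maximalFunction μ N f x
    · obtain ⟨q, hq⟩ := lt_iSup_iff.1 hx
      obtain ⟨hq0, hq⟩ := lt_iSup_iff.1 hq
      have hq0' : (0 : ℝ) < q := by exact_mod_cast hq0
      refine ⟨q, fun _ => ⟨hq0', ?_⟩⟩
      calc lam * ENNReal.ofReal ((q : ℝ) ^ N)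
          ≤ (ENNReal.ofReal ((q : ℝ) ^ (-N)) * ∫⁻ z in Metric.ball x q, f z ∂μ)
            * ENNReal.ofReal ((q : ℝ) ^ N) := mul_le_mul_left hq.le _
        _ = ENNReal.ofReal ((q : ℝ) ^ (-N) * (q : ℝ) ^ N)
            * ∫⁻ z in Metric.ball x q, f z ∂μ := by
              rw [ENNReal.ofReal_mul (by positivity)]; ring
        _ = _ := by
              rw [← Real.rpow_add hq0', neg_add_cancel, Real.rpow_zero, ENNReal.ofReal_one, one_mul]
    · exact ⟨0, fun h => absurd h hx⟩
  choose r hr using hex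
  set E := {x | lam < maximalFunction μ N f x} with hE
  -- The covering lemma needs bounded radii; λ r^N ≤ ∫ f < ∞ provides the bound.
  have hbdd : ∀ x ∈ E, r x ≤ ((∫⁻ z, f z ∂μ) / lam).toReal ^ (1 / N) := by
    intro x hx
    obtain ⟨h1, h2⟩ := hr x hx
    have h3 : ENNReal.ofReal (r x ^ N) ≤ (∫⁻ z, f z ∂μ) / lam := by
      rw [ENNReal.le_div_iff_mul_le (Or.inl h0) (Or.inl htop), mul_comm]
      exact h2.trans (setLIntegral_le_lintegral _ _)
    have h4 := (ENNReal.ofReal_le_iff_le_toReal (ENNReal.div_ne_top hf h0)).1 h3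
    calc r x = (r x ^ N) ^ (1 / N) := by
          rw [← Real.rpow_mul h1.le, mul_one_div_cancel hN.ne', Real.rpow_one]
      _ ≤ _ := Real.rpow_le_rpow (by positivity) h4 (by positivity)
  obtain ⟨u, huE, hdisj, hcov⟩ := Vitali.exists_disjoint_subfamily_covering_enlargement_closedBall
    E id r _ hbdd 5 (by norm_num)
  have hucount : u.Countable := H.countable_of_pairwiseDisjoint (fun x hx => (hr x (huE hx)).1) hdisj
  -- Vitali gives closed balls of radius 5r; the factor 6 passes to open balls.
  have hsub : E ⊆ ⋃ b ∈ u, Metric.ball b (6 * r b) := by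
    intro x hx
    obtain ⟨b, hb, hb'⟩ := hcov x hx
    refine mem_iUnion₂.2 ⟨b, hb, ?_⟩
    refine Metric.closedBall_subset_ball ?_ (hb' (Metric.mem_closedBall_self (hr x hx).1.le))
    linarith [(hr b (huE hb)).1]
  have hball : ∀ b : u, μ (Metric.ball (b : X) (6 * r b))
      ≤ ENNReal.ofReal (C * 6 ^ N) / lam * ∫⁻ z in Metric.ball (b : X) (r b), f z ∂μ := by
    intro b
    obtain ⟨h1, h2⟩ := hr b (huE b.2)
    refine (H.upper b _ (by positivity)).trans ?_
    rw [Real.mul_rpow (by norm_num) h1.le, ← mul_assoc, ENNReal.ofReal_mul (by positivity)]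
    calc ENNReal.ofReal (C * 6 ^ N) * ENNReal.ofReal (r b ^ N)
        = ENNReal.ofReal (C * 6 ^ N) / lam * (lam * ENNReal.ofReal (r b ^ N)) := by
          rw [← mul_assoc, ENNReal.div_mul_cancel h0 htop]
      _ ≤ _ := mul_le_mul_right h2 _
  have := hucount.to_subtype
  calc μ E ≤ μ (⋃ b ∈ u, Metric.ball b (6 * r b)) := measure_mono hsub
    _ ≤ ∑' b : u, μ (Metric.ball (b : X) (6 * r b)) := measure_biUnion_le μ hucount _
    _ ≤ ∑' b : u, ENNReal.ofReal (C * 6 ^ N) / lam * ∫⁻ z in Metric.ball (b : X) (r b), f z ∂μ :=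
        ENNReal.tsum_le_tsum hball
    _ = ENNReal.ofReal (C * 6 ^ N) / lam * ∫⁻ z in ⋃ b ∈ u, Metric.ball b (r b), f z ∂μ := by
        rw [ENNReal.tsum_mul_left, lintegral_biUnion (s := fun b => Metric.ball b (r b)) hucount
          (fun _ _ => Metric.isOpen_ball.measurableSet)
          (hdisj.mono fun _ => Metric.ball_subset_closedBall)]
    _ ≤ _ := mul_le_mul_right (setLIntegral_le_lintegral _ _) _

/-- Where f ≤ t/(2C), it adds at most C · t/(2C) = t/2 to the maximal function. The weak bound at
height t/2 for the remaining part then suffices. -/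
theorem measure_lt_maximalFunction_le_truncated [OpensMeasurableSpace X] (H : BallGrowth μ N c C)
    (f : X → ℝ≥0∞) {t : ℝ} (ht : 0 < t) :
    μ {x | ENNReal.ofReal t < maximalFunction μ N f x} ≤
      ENNReal.ofReal (2 * C * 6 ^ N * t⁻¹) *
        ∫⁻ z, (if ENNReal.ofReal ((2 * C)⁻¹ * t) < f z then f z else 0) ∂μ := by
  have hC := H.upper_pos
  set g : X → ℝ≥0∞ := fun z => if ENNReal.ofReal ((2 * C)⁻¹ * t) < f z then f z else 0 with hg
  have hle : ∀ x, maximalFunction μ N f x ≤ maximalFunction μ N g x + ENNReal.ofReal (t / 2) := by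
    intro x
    refine iSup₂_le fun r hr => ?_
    have hr' : (0 : ℝ) < r := by exact_mod_cast hr
    have hfg : ∀ z, f z ≤ g z + ENNReal.ofReal ((2 * C)⁻¹ * t) := fun z => by
      simp only [hg]
      split_ifs with h
      · exact le_self_add
      · rw [zero_add]; exact not_lt.1 h
    calc ENNReal.ofReal ((r : ℝ) ^ (-N)) * ∫⁻ z in Metric.ball x r, f z ∂μ
        ≤ ENNReal.ofReal ((r : ℝ) ^ (-N)) *
          (∫⁻ z in Metric.ball x r, g z ∂μ + ENNReal.ofReal ((2 * C)⁻¹ * t) *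
            ENNReal.ofReal (C * (r : ℝ) ^ N)) := by
          refine mul_le_mul_right ((lintegral_mono hfg).trans ?_) _
          rw [lintegral_add_right _ measurable_const, setLIntegral_const]
          exact add_le_add_right (mul_le_mul_right (H.upper x _ hr') _) _
      _ = ENNReal.ofReal ((r : ℝ) ^ (-N)) * ∫⁻ z in Metric.ball x r, g z ∂μ
          + ENNReal.ofReal (t / 2) := by
          rw [mul_add, ← ENNReal.ofReal_mul (by positivity), ← ENNReal.ofReal_mul (by positivity)]
          congr 2
          rw [Real.rpow_neg hr'.le]
          field_simp
      _ ≤ _ := by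
          refine add_le_add_left ?_ _
          exact le_iSup₂ (f := fun (r : ℚ) (_ : 0 < r) =>
            ENNReal.ofReal ((r : ℝ) ^ (-N)) * ∫⁻ z in Metric.ball x r, g z ∂μ) r hr
  have hsub : {x | ENNReal.ofReal t < maximalFunction μ N f x} ⊆
      {x | ENNReal.ofReal (t / 2) < maximalFunction μ N g x} := by
    intro x hx
    by_contra hn
    have h1 := (hle x).trans (add_le_add_left (not_lt.1 hn) _)
    rw [← ENNReal.ofReal_add (by positivity) (by positivity), add_halves] at h1
    exact absurd hx (not_lt.2 h1)
  refine (measure_mono hsub).trans ((H.measure_lt_maximalFunction_le g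
    (ENNReal.ofReal_pos.2 (half_pos ht)).ne' ENNReal.ofReal_ne_top).trans (le_of_eq ?_))
  rw [← ENNReal.ofReal_div_of_pos (half_pos ht)]
  congr 2
  field_simp

/-- Marcinkiewicz interpolation between the weak L^1 bound and the trivial L^∞ bound: layer cake,
the truncated weak estimate at each height, then Tonelli. -/
theorem lintegral_maximalFunction_rpow_le_of_measurable [OpensMeasurableSpace X]
    (H : BallGrowth μ N c C) {f : X → ℝ≥0∞} (hf : Measurable f) {p : ℝ} (hp : 1 < p) :
    ∫⁻ x, maximalFunction μ N f x ^ p ∂μ ≤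
      ENNReal.ofReal (2 * C * 6 ^ N * p / (p - 1) * (2 * C) ^ (p - 1)) * ∫⁻ x, f x ^ p ∂μ := by
  have := H.secondCountableTopology
  have := H.sigmaFinite
  have hC := H.upper_pos
  have hp0 : 0 < p := by linarith
  have hp1 : 0 < p - 1 := by linarith
  have hM := measurable_maximalFunction (μ := μ) (N := N) hf
  set A : ℝ := 2 * C * 6 ^ N with hA
  have hA0 : 0 < A := by positivity
  set δ : ℝ := (2 * C)⁻¹ with hδ
  have hδ0 : 0 < δ := by positivity
  calc ∫⁻ x, maximalFunction μ N f x ^ p ∂μ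
      = ∫⁻ x, (∫⁻ t in Ioi (0 : ℝ), (if ENNReal.ofReal t < maximalFunction μ N f x then
          ENNReal.ofReal (p * t ^ (p - 1)) else 0)) ∂μ := by
        simp_rw [lintegral_layer hp0]
    _ = ∫⁻ t in Ioi (0 : ℝ), ∫⁻ x, (if ENNReal.ofReal t < maximalFunction μ N f x then
          ENNReal.ofReal (p * t ^ (p - 1)) else 0) ∂μ := by
        refine lintegral_lintegral_swap (Measurable.aemeasurable ?_)
        refine Measurable.ite ?_ (by fun_prop) measurable_const
        exact measurableSet_lt (ENNReal.measurable_ofReal.comp measurable_snd)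
          (hM.comp measurable_fst)
    _ ≤ ∫⁻ t in Ioi (0 : ℝ), ∫⁻ x, f x * ENNReal.ofReal (A * p * t ^ (p - 1 - 1)) *
          (if ENNReal.ofReal (δ * t) < f x then 1 else 0) ∂μ := by
        refine setLIntegral_mono' measurableSet_Ioi fun t ht => ?_
        have ht : 0 < t := ht
        have h1 : ∫⁻ x, (if ENNReal.ofReal t < maximalFunction μ N f x then
            ENNReal.ofReal (p * t ^ (p - 1)) else 0) ∂μ
            = ENNReal.ofReal (p * t ^ (p - 1)) *
              μ {x | ENNReal.ofReal t < maximalFunction μ N f x} := by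
          have hm : MeasurableSet {x | ENNReal.ofReal t < maximalFunction μ N f x} :=
            measurableSet_lt measurable_const hM
          rw [← lintegral_indicator_const hm]
          refine lintegral_congr fun x => ?_
          by_cases hx : ENNReal.ofReal t < maximalFunction μ N f x <;> simp [hx]
        rw [h1]
        refine (mul_le_mul_right (H.measure_lt_maximalFunction_le_truncated f ht) _).trans
          (le_of_eq ?_)
        rw [← mul_assoc, ← ENNReal.ofReal_mul (by positivity),
          ← lintegral_const_mul' _ _ ENNReal.ofReal_ne_top]
        refine lintegral_congr fun x => ?_
        have h2 : p * t ^ (p - 1) * (2 * C * 6 ^ N * t⁻¹) = A * p * t ^ (p - 1 - 1) := by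
          rw [Real.rpow_sub_one ht.ne' (p - 1), hA]; ring
        rw [h2]
        split_ifs
        · rw [mul_one, mul_comm]
        · simp
    _ = ∫⁻ x, (∫⁻ t in Ioi (0 : ℝ), f x * ENNReal.ofReal (A * p * t ^ (p - 1 - 1)) *
          (if ENNReal.ofReal (δ * t) < f x then 1 else 0)) ∂μ := by
        refine lintegral_lintegral_swap (Measurable.aemeasurable ?_)
        refine Measurable.mul (Measurable.mul (hf.comp measurable_snd) (by fun_prop)) ?_
        refine Measurable.ite ?_ measurable_const measurable_const
        exact measurableSet_lt (by fun_prop) (hf.comp measurable_snd)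
    -- For fixed x the t-integral is again a layer integral, now with exponent p - 1 > 0 and value
    -- f(x)/δ.
    _ = ∫⁻ x, ENNReal.ofReal (A * p / (p - 1) * (2 * C) ^ (p - 1)) * f x ^ p ∂μ := by
        refine lintegral_congr fun x => ?_
        have h1 : ∀ t : ℝ, f x * ENNReal.ofReal (A * p * t ^ (p - 1 - 1)) *
            (if ENNReal.ofReal (δ * t) < f x then 1 else 0)
            = f x * ENNReal.ofReal (A * p / (p - 1)) *
              (if ENNReal.ofReal t < f x / ENNReal.ofReal δ then
                ENNReal.ofReal ((p - 1) * t ^ (p - 1 - 1)) else 0) := by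
          intro t
          have h2 : ENNReal.ofReal (δ * t) < f x ↔ ENNReal.ofReal t < f x / ENNReal.ofReal δ := by
            rw [ENNReal.lt_div_iff_mul_lt (Or.inl (ENNReal.ofReal_pos.2 hδ0).ne')
              (Or.inl ENNReal.ofReal_ne_top), ← ENNReal.ofReal_mul' hδ0.le, mul_comm]
          simp only [h2]
          split_ifs
          · rw [mul_one, mul_assoc (f x), ← ENNReal.ofReal_mul (by positivity)]
            congr 2
            field_simp
          · simp
        have hm : Measurable fun t : ℝ => (if ENNReal.ofReal t < f x / ENNReal.ofReal δ then
            ENNReal.ofReal ((p - 1) * t ^ (p - 1 - 1)) else 0) :=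
          Measurable.ite (measurableSet_lt ENNReal.measurable_ofReal measurable_const)
            (by fun_prop) measurable_const
        simp_rw [h1]
        rw [lintegral_const_mul _ hm, lintegral_layer hp1, ENNReal.div_rpow_of_nonneg _ _ hp1.le,
          ENNReal.ofReal_rpow_of_pos hδ0, ENNReal.div_eq_inv_mul,
          ← ENNReal.ofReal_inv_of_pos (by positivity), hδ, Real.inv_rpow (by positivity), inv_inv,
          ENNReal.ofReal_mul (by positivity : 0 ≤ A * p / (p - 1))]
        have h3 : f x ^ p = f x * f x ^ (p - 1) := by
          conv_lhs => rw [← add_sub_cancel 1 p]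
          rw [ENNReal.rpow_add_of_nonneg _ _ zero_le_one hp1.le, ENNReal.rpow_one]
        rw [h3]
        ring
    _ = _ := by rw [lintegral_const_mul' _ _ ENNReal.ofReal_ne_top]

theorem lintegral_maximalFunction_rpow_le [OpensMeasurableSpace X]
    (H : BallGrowth μ N c C) {p : ℝ} (hp : 1 < p) :
    ∃ K : ℝ≥0, ∀ f : X → ℝ≥0∞, AEMeasurable f μ →
      ∫⁻ x, maximalFunction μ N f x ^ p ∂μ ≤ K * ∫⁻ x, f x ^ p ∂μ := by
  refine ⟨(2 * C * 6 ^ N * p / (p - 1) * (2 * C) ^ (p - 1)).toNNReal, fun f hf => ?_⟩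
  rw [maximalFunction_congr hf.ae_eq_mk,
    lintegral_congr_ae (hf.ae_eq_mk.mono fun x hx => congrArg (· ^ p) hx)]
  exact H.lintegral_maximalFunction_rpow_le_of_measurable hf.measurable_mk hp

theorem measurable_maximalFunction_of_aemeasurable [OpensMeasurableSpace X] (H : BallGrowth μ N c C)
    {f : X → ℝ≥0∞} (hf : AEMeasurable f μ) : Measurable (maximalFunction μ N f) := by
  have := H.secondCountableTopology
  have := H.sigmaFinite
  rw [maximalFunction_congr hf.ae_eq_mk]
  exact measurable_maximalFunction hf.measurable_mk

end BallGrowth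

end Maximal

/-! ### Power bounds for the Bessel weight. -/

section Weight

/-- The weight `α t^α / (1 + t^α)^2 · 1/t` of the Bessel kernel. -/
noncomputable def besselWeight (α t : ℝ) : ℝ := α * (t ^ α / (1 + t ^ α) ^ 2) / t

theorem measurable_besselWeight (α : ℝ) : Measurable (besselWeight α) := by
  unfold besselWeight
  fun_prop

theorem besselWeight_nonneg {α t : ℝ} (hα : 0 ≤ α) (ht : 0 < t) : 0 ≤ besselWeight α t := by
  unfold besselWeight
  positivity

/-- The factor t^α/(1+t^α)^2 is at most t^α ≤ t^β for t ≤ 1 and at most 1 ≤ t^β for t ≥ 1. The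
freedom in β makes all intermediate exponents q accessible. -/
theorem besselWeight_le {α β t : ℝ} (hβ : 0 ≤ β) (hβα : β ≤ α) (ht : 0 < t) :
    besselWeight α t ≤ α * t ^ (β - 1) := by
  have hα : 0 ≤ α := hβ.trans hβα
  have hu : 0 < t ^ α := Real.rpow_pos_of_pos ht α
  have key : t ^ α / (1 + t ^ α) ^ 2 ≤ t ^ β := by
    rcases le_total t 1 with h1 | h1
    · refine (div_le_self hu.le (by nlinarith)).trans ?_
      exact Real.rpow_le_rpow_of_exponent_ge ht h1 hβα
    · refine le_trans ?_ (Real.one_le_rpow h1 hβ)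
      rw [div_le_one (by positivity)]
      nlinarith
  unfold besselWeight
  rw [Real.rpow_sub_one ht.ne', ← mul_div_assoc α (t ^ β)]
  exact div_le_div_of_nonneg_right (mul_le_mul_of_nonneg_left key hα) ht.le

end Weight

/-! ### Potentials split by scale. -/

section ScalePotential

variable {X : Type*} [MeasurableSpace X] {μ : Measure X} {N c C K : ℝ}
  {s : X → X → ℝ → ℝ} {α : ℝ} {g : X → ℝ}

/-- The Bessel-type potential built from a general family of kernels `s(x, z, t)`. -/
noncomputable def scalePotential (μ : Measure X) (s : X → X → ℝ → ℝ) (α : ℝ) (g : X → ℝ) (x : X) :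
    ℝ :=
  ∫ z, (∫ t in Ioi (0 : ℝ), g z * (besselWeight α t * s x z t)) ∂μ

/-- `∫ |g(z)| |s(x, z, t)| dμ(z)`. -/
noncomputable def scaleAverage (μ : Measure X) (s : X → X → ℝ → ℝ) (g : X → ℝ) (x : X) (t : ℝ) :
    ℝ≥0∞ :=
  ∫⁻ z, ‖g z‖ₑ * ‖s x z t‖ₑ ∂μ

/-- The part of the absolute integral defining the potential coming from the scales in `T`. -/
noncomputable def potentialMajorant (μ : Measure X) (s : X → X → ℝ → ℝ) (α : ℝ) (g : X → ℝ)
    (x : X) (T : Set ℝ) : ℝ≥0∞ :=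
  ∫⁻ t in T, ENNReal.ofReal (besselWeight α t) * scaleAverage μ s g x t

theorem potentialMajorant_Ioi_eq_add (x : X) {r : ℝ} (hr : 0 < r) :
    potentialMajorant μ s α g x (Ioi 0) =
      potentialMajorant μ s α g x (Ioc 0 r) + potentialMajorant μ s α g x (Ioi r) := by
  unfold potentialMajorant
  rw [← Ioc_union_Ioi_eq_Ioi hr.le, lintegral_union measurableSet_Ioi (Ioc_disjoint_Ioi le_rfl)]

variable [MetricSpace X]

theorem besselPotential_eq_scalePotential (h : ℝ → ℝ) :
    besselPotential μ N h α g = scalePotential μ (kernelS μ N h) α g := by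
  funext x
  unfold besselPotential scalePotential besselKernel besselWeight
  refine integral_congr_ae (ae_of_all _ fun z => ?_)
  simp only
  rw [← integral_const_mul, ← integral_const_mul]
  refine integral_congr_ae (ae_of_all _ fun t => ?_)
  simp only
  ring

theorem IsScaleKernel.aestronglyMeasurable_integrand [SFinite μ] (hs : IsScaleKernel N K s)
    (hg : AEStronglyMeasurable g μ) (x : X) (ν : Measure ℝ) [SFinite ν] :
    AEStronglyMeasurable (fun q : X × ℝ => g q.1 * (besselWeight α q.2 * s x q.1 q.2))
      (μ.prod ν) :=
  (hg.comp_fst).mul ((((measurable_besselWeight α).comp measurable_snd).mul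
    (hs.measurable x)).aestronglyMeasurable)

theorem IsScaleKernel.lintegral_enorm_integrand [SFinite μ] (hs : IsScaleKernel N K s) (hα : 0 ≤ α)
    (hg : AEStronglyMeasurable g μ) (x : X) {T : Set ℝ} (hT : MeasurableSet T) (hT0 : T ⊆ Ioi 0) :
    ∫⁻ q, ‖g q.1 * (besselWeight α q.2 * s x q.1 q.2)‖ₑ ∂(μ.prod (volume.restrict T)) =
      potentialMajorant μ s α g x T := by
  rw [lintegral_prod_symm _ (hs.aestronglyMeasurable_integrand hg x _).enorm]
  unfold potentialMajorant scaleAverage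
  refine setLIntegral_congr_fun hT fun t ht => ?_
  simp only
  rw [← lintegral_const_mul' _ _ ENNReal.ofReal_ne_top]
  refine lintegral_congr fun z => ?_
  rw [enorm_mul, enorm_mul, Real.enorm_of_nonneg (besselWeight_nonneg hα (hT0 ht))]
  ring

/-- No convergence is assumed: a divergent Bochner integral is 0 by convention, so the bound
persists. -/
theorem IsScaleKernel.enorm_scalePotential_le [SFinite μ] (hs : IsScaleKernel N K s) (hα : 0 ≤ α)
    (hg : AEStronglyMeasurable g μ) (x : X) :
    ‖scalePotential μ s α g x‖ₑ ≤ potentialMajorant μ s α g x (Ioi 0) := by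
  rw [← hs.lintegral_enorm_integrand hα hg x measurableSet_Ioi Subset.rfl,
    lintegral_prod _ (hs.aestronglyMeasurable_integrand hg x _).enorm]
  exact (enorm_integral_le_lintegral_enorm _).trans
    (lintegral_mono fun z => enorm_integral_le_lintegral_enorm _)

theorem IsScaleKernel.integrable_integrand [SFinite μ] (hs : IsScaleKernel N K s) (hα : 0 ≤ α)
    (hg : AEStronglyMeasurable g μ) {x : X} (hx : potentialMajorant μ s α g x (Ioi 0) < ⊤) :
    Integrable (fun q : X × ℝ => g q.1 * (besselWeight α q.2 * s x q.1 q.2))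
      (μ.prod (volume.restrict (Ioi 0))) := by
  refine ⟨hs.aestronglyMeasurable_integrand hg x _, ?_⟩
  rw [HasFiniteIntegral, hs.lintegral_enorm_integrand hα hg x measurableSet_Ioi Subset.rfl]
  exact hx

/-- Finite majorants permit writing the difference as one absolutely convergent double integral.
Cancellation in s is kept only for scales above r. -/
theorem IsScaleKernel.enorm_scalePotential_sub_le [SFinite μ] (hs : IsScaleKernel N K s)
    (hα : 0 ≤ α) (hg : AEStronglyMeasurable g μ) {x x' : X} {r : ℝ} (hr : 0 < r)
    (hx : potentialMajorant μ s α g x (Ioi 0) < ⊤)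
    (hx' : potentialMajorant μ s α g x' (Ioi 0) < ⊤) :
    ‖scalePotential μ s α g x - scalePotential μ s α g x'‖ₑ ≤
      potentialMajorant μ s α g x (Ioc 0 r) + potentialMajorant μ s α g x' (Ioc 0 r) +
      ∫⁻ t in Ioi r, ENNReal.ofReal (besselWeight α t) *
        ∫⁻ z, ‖g z‖ₑ * ‖s x z t - s x' z t‖ₑ ∂μ := by
  set F : X → X × ℝ → ℝ := fun x q => g q.1 * (besselWeight α q.2 * s x q.1 q.2) with hF
  have hi := hs.integrable_integrand hα hg hx
  have hi' := hs.integrable_integrand hα hg hx'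
  have hm : ∀ (y : X) (ν : Measure ℝ) [SFinite ν], AEStronglyMeasurable (F y) (μ.prod ν) :=
    fun y ν _ => hs.aestronglyMeasurable_integrand hg y ν
  have h1 : scalePotential μ s α g x - scalePotential μ s α g x'
      = ∫ q, (F x q - F x' q) ∂(μ.prod (volume.restrict (Ioi 0))) := by
    rw [integral_sub hi hi', integral_prod _ hi, integral_prod _ hi']
    rfl
  rw [h1]
  refine (enorm_integral_le_lintegral_enorm _).trans ?_
  rw [← Ioc_union_Ioi_eq_Ioi hr.le, Measure.restrict_union
    (Ioc_disjoint_Ioi le_rfl) measurableSet_Ioi,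
    Measure.prod_add, lintegral_add_measure]
  refine add_le_add ?_ (le_of_eq ?_)
  · rw [← hs.lintegral_enorm_integrand hα hg x measurableSet_Ioc Ioc_subset_Ioi_self,
      ← hs.lintegral_enorm_integrand hα hg x' measurableSet_Ioc Ioc_subset_Ioi_self,
      ← lintegral_add_left' (hm x _).enorm]
    exact lintegral_mono fun q => enorm_sub_le
  · rw [lintegral_prod_symm (fun q => ‖F x q - F x' q‖ₑ) ((hm x _).sub (hm x' _)).enorm]
    refine setLIntegral_congr_fun measurableSet_Ioi fun t ht => ?_
    simp only [hF]
    rw [← lintegral_const_mul' _ _ ENNReal.ofReal_ne_top]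
    refine lintegral_congr fun z => ?_
    rw [← mul_sub, ← mul_sub, enorm_mul, enorm_mul,
      Real.enorm_of_nonneg (besselWeight_nonneg hα (hr.trans ht))]
    ring

theorem IsScaleKernel.scaleAverage_le_lintegral_ball [OpensMeasurableSpace X]
    (hs : IsScaleKernel N K s) (x : X) {t : ℝ} (ht : 0 < t) :
    scaleAverage μ s g x t ≤
      ENNReal.ofReal (K * t ^ (-N)) * ∫⁻ z in Metric.ball x (4 * t), ‖g z‖ₑ ∂μ := by
  rw [← lintegral_const_mul' _ _ ENNReal.ofReal_ne_top,
    ← lintegral_indicator Metric.isOpen_ball.measurableSet]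
  refine lintegral_mono fun z => ?_
  by_cases hz : z ∈ Metric.ball x (4 * t)
  · rw [indicator_of_mem hz, mul_comm, Real.enorm_eq_ofReal_abs (s x z t)]
    exact mul_le_mul_left (ENNReal.ofReal_le_ofReal (hs.bound x z t ht)) _
  · simp [hs.eq_zero x z t ht hz]

theorem BallGrowth.lintegral_ball_le (H : BallGrowth μ N c C) {p : ℝ} (hp : 1 < p)
    (hg : AEStronglyMeasurable g μ) (x : X) {r : ℝ} (hr : 0 < r) :
    ∫⁻ z in Metric.ball x r, ‖g z‖ₑ ∂μ ≤
      ENNReal.ofReal ((C * r ^ N) ^ (1 - 1 / p)) * eLpNorm g (ENNReal.ofReal p) μ := by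
  have hp0 : 0 < p := by linarith
  have hC := H.upper_pos
  have he : 0 ≤ 1 - 1 / p := by
    rw [sub_nonneg, div_le_one hp0]; exact hp.le
  have h1 := eLpNorm_le_eLpNorm_mul_rpow_measure_univ (p := 1) (q := ENNReal.ofReal p)
    (by simpa using hp.le) (hg.restrict (s := Metric.ball x r))
  rw [eLpNorm_one_eq_lintegral_enorm, Measure.restrict_apply_univ, ENNReal.toReal_one,
    ENNReal.toReal_ofReal hp0.le, div_one] at h1
  rw [mul_comm]
  refine h1.trans (mul_le_mul' (eLpNorm_mono_measure _ Measure.restrict_le_self) ?_)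
  rw [← ENNReal.ofReal_rpow_of_nonneg (by positivity) he]
  exact ENNReal.rpow_le_rpow (H.upper x r hr) he

/-- Homogeneity count: -N + N(1 - 1/p) = -N/p. -/
theorem rpow_neg_mul_rpow_ball {p t R : ℝ} (hC : 0 < C) (hR : 0 < R) (ht : 0 < t) :
    t ^ (-N) * (C * (R * t) ^ N) ^ (1 - 1 / p) = (C * R ^ N) ^ (1 - 1 / p) * t ^ (-(N / p)) := by
  rw [Real.mul_rpow hR.le ht.le, ← mul_assoc, Real.mul_rpow (by positivity) (by positivity),
    ← Real.rpow_mul ht.le, mul_left_comm, ← Real.rpow_add ht]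
  congr 2
  ring

theorem IsScaleKernel.scaleAverage_le_eLpNorm [OpensMeasurableSpace X]
    (hs : IsScaleKernel N K s) (H : BallGrowth μ N c C) {p : ℝ} (hp : 1 < p)
    (hg : AEStronglyMeasurable g μ) (x : X) {t : ℝ} (ht : 0 < t) :
    scaleAverage μ s g x t ≤ ENNReal.ofReal (K * (C * 4 ^ N) ^ (1 - 1 / p) * t ^ (-(N / p))) *
      eLpNorm g (ENNReal.ofReal p) μ := by
  have hK := hs.const_nonneg
  refine (hs.scaleAverage_le_lintegral_ball x ht).trans
    ((mul_le_mul_right (H.lintegral_ball_le hp hg x (r := 4 * t) (by positivity)) _).trans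
      (le_of_eq ?_))
  rw [← mul_assoc, ← ENNReal.ofReal_mul (by positivity), mul_assoc K, mul_assoc K,
    rpow_neg_mul_rpow_ball H.upper_pos (by norm_num) ht]

theorem IsScaleKernel.scaleAverage_le_maximalFunction [OpensMeasurableSpace X]
    (hs : IsScaleKernel N K s) (hN : 0 < N) (x : X) {t : ℝ} (ht : 0 < t) :
    scaleAverage μ s g x t ≤ ENNReal.ofReal (K * 4 ^ N * 2 ^ N) *
      maximalFunction μ N (fun z => ‖g z‖ₑ) x := by
  have hK := hs.const_nonneg
  have h4 : K * t ^ (-N) = K * 4 ^ N * (4 * t) ^ (-N) := by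
    rw [Real.mul_rpow (by norm_num) ht.le, Real.rpow_neg (by norm_num : (0 : ℝ) ≤ 4), mul_assoc,
      mul_inv_cancel_left₀ (by positivity)]
  refine (hs.scaleAverage_le_lintegral_ball x ht).trans ?_
  rw [h4, ENNReal.ofReal_mul (by positivity), mul_assoc,
    ENNReal.ofReal_mul (by positivity : 0 ≤ K * 4 ^ N), mul_assoc]
  exact mul_le_mul_right (le_maximalFunction hN _ x (by positivity)) _

/-- The Lipschitz bound gains r/t. Both kernels live in B(x, 6t), because d(x,x') ≤ 2r < 2t. -/
theorem IsScaleKernel.lintegral_sub_le [OpensMeasurableSpace X]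
    (hs : IsScaleKernel N K s) (H : BallGrowth μ N c C) {p : ℝ} (hp : 1 < p)
    (hg : AEStronglyMeasurable g μ) {x x' : X} {r t : ℝ} (hr : 0 < r) (hxx' : dist x x' ≤ 2 * r)
    (hrt : r < t) :
    ∫⁻ z, ‖g z‖ₑ * ‖s x z t - s x' z t‖ₑ ∂μ ≤
      ENNReal.ofReal (2 * K * (C * 6 ^ N) ^ (1 - 1 / p) * r * t ^ (-(N / p) - 1)) *
        eLpNorm g (ENNReal.ofReal p) μ := by
  have hK := hs.const_nonneg
  have ht : 0 < t := hr.trans hrt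
  have h1 : ∫⁻ z, ‖g z‖ₑ * ‖s x z t - s x' z t‖ₑ ∂μ ≤
      ENNReal.ofReal (K * t ^ (-N) * (2 * r / t)) * ∫⁻ z in Metric.ball x (6 * t), ‖g z‖ₑ ∂μ := by
    rw [← lintegral_const_mul' _ _ ENNReal.ofReal_ne_top,
      ← lintegral_indicator Metric.isOpen_ball.measurableSet]
    refine lintegral_mono fun z => ?_
    by_cases hz : z ∈ Metric.ball x (6 * t)
    · rw [indicator_of_mem hz, mul_comm, Real.enorm_eq_ofReal_abs (s x z t - s x' z t)]
      refine mul_le_mul_left (ENNReal.ofReal_le_ofReal ((hs.lipschitz x x' z t ht).trans ?_)) _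
      gcongr
    · have h2 : z ∉ Metric.ball x (4 * t) := fun h =>
        hz (Metric.ball_subset_ball (by linarith) h)
      have h3 : z ∉ Metric.ball x' (4 * t) := fun h => hz (by
        rw [Metric.mem_ball] at h ⊢
        linarith [dist_triangle z x' x, dist_comm x x'])
      simp [hs.eq_zero x z t ht h2, hs.eq_zero x' z t ht h3]
  refine h1.trans ((mul_le_mul_right (H.lintegral_ball_le hp hg x (r := 6 * t) (by positivity))
    _).trans (le_of_eq ?_))
  rw [← mul_assoc, ← ENNReal.ofReal_mul (by positivity),
    show K * t ^ (-N) * (2 * r / t) * (C * (6 * t) ^ N) ^ (1 - 1 / p)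
      = K * (2 * r / t) * (t ^ (-N) * (C * (6 * t) ^ N) ^ (1 - 1 / p)) by ring,
    rpow_neg_mul_rpow_ball H.upper_pos (by norm_num) ht, Real.rpow_sub_one ht.ne']
  congr 2
  ring

/-- Small scales against Mg(x): t^(β-1) is integrable at 0 since β > 0. -/
theorem IsScaleKernel.potentialMajorant_Ioc_le_maximalFunction [OpensMeasurableSpace X]
    (hs : IsScaleKernel N K s) (hN : 0 < N) {β : ℝ} (hβ : 0 < β) (hβα : β ≤ α) (x : X) {r : ℝ}
    (hr : 0 < r) :
    potentialMajorant μ s α g x (Ioc 0 r) ≤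
      ENNReal.ofReal (α / β * (K * 4 ^ N * 2 ^ N) * r ^ β) *
        maximalFunction μ N (fun z => ‖g z‖ₑ) x := by
  have hK := hs.const_nonneg
  have hα : 0 < α := hβ.trans_le hβα
  set M := maximalFunction μ N (fun z => ‖g z‖ₑ) x
  calc potentialMajorant μ s α g x (Ioc 0 r)
      ≤ ∫⁻ t in Ioc 0 r, ENNReal.ofReal (t ^ (β - 1)) *
          (ENNReal.ofReal α * (ENNReal.ofReal (K * 4 ^ N * 2 ^ N) * M)) := by
        refine setLIntegral_mono' measurableSet_Ioc fun t ht => ?_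
        rw [← mul_assoc]
        refine mul_le_mul' ?_ (hs.scaleAverage_le_maximalFunction hN x ht.1)
        rw [mul_comm, ← ENNReal.ofReal_mul hα.le]
        exact ENNReal.ofReal_le_ofReal (besselWeight_le hβ.le hβα ht.1)
    _ = _ := by
        rw [lintegral_mul_const _ (by fun_prop), lintegral_Ioc_rpow hβ hr.le,
          ← mul_assoc, ← mul_assoc, ← ENNReal.ofReal_mul (by positivity),
          ← ENNReal.ofReal_mul (by positivity)]
        congr 2
        field_simp

/-- The integrand t^(α-N/p-1) is integrable at 0 exactly in the supercritical range. -/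
theorem IsScaleKernel.potentialMajorant_Ioc_le_eLpNorm [OpensMeasurableSpace X]
    (hs : IsScaleKernel N K s) (H : BallGrowth μ N c C) {p : ℝ} (hp : 1 < p)
    (hαp : N / p < α) (hg : AEStronglyMeasurable g μ) (x : X) {r : ℝ} (hr : 0 < r) :
    potentialMajorant μ s α g x (Ioc 0 r) ≤
      ENNReal.ofReal (α / (α - N / p) * (K * (C * 4 ^ N) ^ (1 - 1 / p)) * r ^ (α - N / p)) *
        eLpNorm g (ENNReal.ofReal p) μ := by
  have hK := hs.const_nonneg
  have hC := H.upper_pos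
  have hN := H.dim_pos
  have hα : 0 < α := lt_trans (by positivity) hαp
  have hσ : 0 < α - N / p := sub_pos.2 hαp
  set G := eLpNorm g (ENNReal.ofReal p) μ
  set A := K * (C * 4 ^ N) ^ (1 - 1 / p) with hA
  have hA0 : 0 ≤ A := by positivity
  calc potentialMajorant μ s α g x (Ioc 0 r)
      ≤ ∫⁻ t in Ioc 0 r, ENNReal.ofReal (t ^ (α - N / p - 1)) * (ENNReal.ofReal (α * A) * G) := by
        refine setLIntegral_mono' measurableSet_Ioc fun t ht => ?_
        have ht0 : 0 < t := ht.1
        refine (mul_le_mul' (ENNReal.ofReal_le_ofReal (besselWeight_le hα.le le_rfl ht0))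
          (hs.scaleAverage_le_eLpNorm H hp hg x ht0)).trans (le_of_eq ?_)
        rw [← mul_assoc, ← mul_assoc, ← ENNReal.ofReal_mul (by positivity),
          ← ENNReal.ofReal_mul (by positivity), ← hA,
          show α - N / p - 1 = (α - 1) + -(N / p) by ring, Real.rpow_add ht0]
        congr 2
        ring
    _ = _ := by
        rw [lintegral_mul_const _ (by fun_prop), lintegral_Ioc_rpow hσ hr.le,
          ← mul_assoc, ← ENNReal.ofReal_mul (by positivity)]
        congr 2
        field_simp

/-- Convergence at infinity comes from t^(-N/p), so even β = 0 is admissible. -/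
theorem IsScaleKernel.potentialMajorant_Ioi_le_eLpNorm [OpensMeasurableSpace X]
    (hs : IsScaleKernel N K s) (H : BallGrowth μ N c C) {p β : ℝ} (hp : 1 < p)
    (hβ : 0 ≤ β) (hβα : β ≤ α) (hβp : β < N / p)
    (hg : AEStronglyMeasurable g μ) (x : X) {r : ℝ} (hr : 0 < r) :
    potentialMajorant μ s α g x (Ioi r) ≤
      ENNReal.ofReal (α / (N / p - β) * (K * (C * 4 ^ N) ^ (1 - 1 / p)) * r ^ (β - N / p)) *
        eLpNorm g (ENNReal.ofReal p) μ := by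
  have hK := hs.const_nonneg
  have hC := H.upper_pos
  have hα : 0 ≤ α := hβ.trans hβα
  have hσ : 0 < N / p - β := sub_pos.2 hβp
  set G := eLpNorm g (ENNReal.ofReal p) μ
  set A := K * (C * 4 ^ N) ^ (1 - 1 / p) with hA
  have hA0 : 0 ≤ A := by positivity
  calc potentialMajorant μ s α g x (Ioi r)
      ≤ ∫⁻ t in Ioi r, ENNReal.ofReal (t ^ (-(N / p - β) - 1)) *
          (ENNReal.ofReal (α * A) * G) := by
        refine setLIntegral_mono' measurableSet_Ioi fun t ht => ?_
        have ht0 : 0 < t := hr.trans ht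
        refine (mul_le_mul' (ENNReal.ofReal_le_ofReal (besselWeight_le hβ hβα ht0))
          (hs.scaleAverage_le_eLpNorm H hp hg x ht0)).trans (le_of_eq ?_)
        rw [← mul_assoc, ← mul_assoc, ← ENNReal.ofReal_mul (by positivity),
          ← ENNReal.ofReal_mul (by positivity), ← hA,
          show -(N / p - β) - 1 = (β - 1) + -(N / p) by ring, Real.rpow_add ht0]
        congr 2
        ring
    _ = _ := by
        rw [lintegral_mul_const _ (by fun_prop), lintegral_Ioi_rpow_neg hσ hr,
          ← mul_assoc, ← ENNReal.ofReal_mul (by positivity), neg_sub]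
        congr 2
        field_simp

theorem IsScaleKernel.lintegral_Ioi_sub_le [OpensMeasurableSpace X]
    (hs : IsScaleKernel N K s) (H : BallGrowth μ N c C) {p : ℝ} (hp : 1 < p) (hα : 0 ≤ α)
    (hαp : α < 1 + N / p)
    (hg : AEStronglyMeasurable g μ) {x x' : X} {r : ℝ} (hr : 0 < r) (hxx' : dist x x' ≤ 2 * r) :
    ∫⁻ t in Ioi r, ENNReal.ofReal (besselWeight α t) *
        ∫⁻ z, ‖g z‖ₑ * ‖s x z t - s x' z t‖ₑ ∂μ ≤
      ENNReal.ofReal (α / (1 + N / p - α) * (2 * K * (C * 6 ^ N) ^ (1 - 1 / p)) * r ^ (α - N / p)) *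
        eLpNorm g (ENNReal.ofReal p) μ := by
  have hK := hs.const_nonneg
  have hC := H.upper_pos
  have hσ : 0 < 1 + N / p - α := sub_pos.2 hαp
  set G := eLpNorm g (ENNReal.ofReal p) μ
  set A := 2 * K * (C * 6 ^ N) ^ (1 - 1 / p) with hA
  have hA0 : 0 ≤ A := by positivity
  calc ∫⁻ t in Ioi r, ENNReal.ofReal (besselWeight α t) *
        ∫⁻ z, ‖g z‖ₑ * ‖s x z t - s x' z t‖ₑ ∂μ
      ≤ ∫⁻ t in Ioi r, ENNReal.ofReal (t ^ (-(1 + N / p - α) - 1)) *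
          (ENNReal.ofReal (α * A * r) * G) := by
        refine setLIntegral_mono' measurableSet_Ioi fun t ht => ?_
        have ht0 : 0 < t := hr.trans ht
        refine (mul_le_mul' (ENNReal.ofReal_le_ofReal (besselWeight_le hα le_rfl ht0))
          (hs.lintegral_sub_le H hp hg hr hxx' ht)).trans (le_of_eq ?_)
        rw [← mul_assoc, ← mul_assoc, ← ENNReal.ofReal_mul (by positivity),
          ← ENNReal.ofReal_mul (by positivity), ← hA,
          show -(1 + N / p - α) - 1 = (α - 1) + (-(N / p) - 1) by ring, Real.rpow_add ht0]
        congr 2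
        ring
    _ = _ := by
        rw [lintegral_mul_const _ (by fun_prop), lintegral_Ioi_rpow_neg hσ hr,
          ← mul_assoc, ← ENNReal.ofReal_mul (by positivity),
          show α - N / p = -(1 + N / p - α) + 1 by ring, Real.rpow_add_one hr.ne']
        congr 2
        field_simp

end ScalePotential

/-! ### Optimising the scale; mean oscillation from differences. -/

section Inequalities

/-- The choice r = (G/M)^(1/γ) balances r^β M against r^(β-γ) G. -/
theorem le_of_forall_scale_le {Q M G : ℝ≥0∞} {A A' β γ : ℝ} (hβ : 0 < β) (hβγ : β < γ)
    (hA : 0 ≤ A) (hA' : 0 ≤ A') (hM0 : M ≠ 0) (hM : M ≠ ⊤) (hG0 : G ≠ 0) (hG : G ≠ ⊤)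
    (h : ∀ r : ℝ, 0 < r →
      Q ≤ ENNReal.ofReal (A * r ^ β) * M + ENNReal.ofReal (A' * r ^ (β - γ)) * G) :
    Q ≤ ENNReal.ofReal (A + A') * (M ^ (1 - β / γ) * G ^ (β / γ)) := by
  have hγ : 0 < γ := hβ.trans hβγ
  obtain ⟨m, hm, rfl⟩ : ∃ m : ℝ, 0 < m ∧ M = ENNReal.ofReal m :=
    ⟨M.toReal, ENNReal.toReal_pos hM0 hM, (ENNReal.ofReal_toReal hM).symm⟩
  obtain ⟨b, hb, rfl⟩ : ∃ b : ℝ, 0 < b ∧ G = ENNReal.ofReal b :=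
    ⟨G.toReal, ENNReal.toReal_pos hG0 hG, (ENNReal.ofReal_toReal hG).symm⟩
  have hr : 0 < (b / m) ^ (1 / γ) := by positivity
  refine (h _ hr).trans (le_of_eq ?_)
  have e1 : ((b / m) ^ (1 / γ)) ^ β * m = m ^ (1 - β / γ) * b ^ (β / γ) := by
    rw [← Real.rpow_mul (by positivity), Real.div_rpow hb.le hm.le, Real.rpow_sub hm, Real.rpow_one,
      show 1 / γ * β = β / γ by ring]
    field_simp
  have e2 : ((b / m) ^ (1 / γ)) ^ (β - γ) * b = m ^ (1 - β / γ) * b ^ (β / γ) := by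
    rw [Real.rpow_sub hr, mul_comm, mul_div_assoc', mul_comm b, ← Real.rpow_mul (by positivity) _ γ,
      one_div_mul_cancel hγ.ne', Real.rpow_one, ← e1]
    field_simp
  rw [ENNReal.ofReal_rpow_of_pos hm, ENNReal.ofReal_rpow_of_pos hb,
    ← ENNReal.ofReal_mul (by positivity), ← ENNReal.ofReal_mul (by positivity),
    ← ENNReal.ofReal_mul (by positivity), ← ENNReal.ofReal_mul (by positivity),
    ← ENNReal.ofReal_add (by positivity) (by positivity), mul_assoc, mul_assoc, e1, e2, add_mul]

theorem setLIntegral_le_rpow_mul_measure {X : Type*} [MeasurableSpace X] {μ : Measure X} {p : ℝ}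
    (hp : 1 < p) {F : X → ℝ≥0∞} (hF : AEMeasurable F μ) (S : Set X) :
    ∫⁻ x in S, F x ∂μ ≤ (∫⁻ x, F x ^ p ∂μ) ^ (1 / p) * μ S ^ (1 - 1 / p) := by
  have hp0 : 0 < p := by linarith
  have h1 := ENNReal.lintegral_mul_le_Lp_mul_Lq (μ.restrict S)
    (Real.HolderConjugate.conjExponent hp) hF.restrict (aemeasurable_const (b := 1))
  have he : 1 / p.conjExponent = 1 - 1 / p := by
    unfold Real.conjExponent
    field_simp
  simp only [Pi.mul_apply, mul_one, ENNReal.one_rpow, lintegral_one, Measure.restrict_apply_univ,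
    he] at h1
  exact h1.trans (mul_le_mul_left (ENNReal.rpow_le_rpow (setLIntegral_le_lintegral _ _)
    (by positivity)) _)

/-- Write f(y) minus its mean as the mean over z of f(y) - f(z); averaging over y and z produces the
two copies of U. -/
theorem lintegral_enorm_sub_integral_le {X : Type*} [MeasurableSpace X] {ν : Measure X}
    [IsProbabilityMeasure ν] {f : X → ℝ} (hf : Integrable f ν) {U : X → ℝ≥0∞}
    {V : ℝ≥0∞} (h : ∀ᵐ y ∂ν, ∀ᵐ z ∂ν, ‖f y - f z‖ₑ ≤ U y + U z + V) :
    ∫⁻ y, ‖f y - ∫ z, f z ∂ν‖ₑ ∂ν ≤ 2 * ∫⁻ y, U y ∂ν + V := by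
  have h1 : ∀ᵐ y ∂ν, ‖f y - ∫ z, f z ∂ν‖ₑ ≤ U y + ((∫⁻ z, U z ∂ν) + V) := by
    filter_upwards [h] with y hy
    have h2 : f y - ∫ z, f z ∂ν = ∫ z, (f y - f z) ∂ν := by
      rw [integral_sub (integrable_const _) hf]; simp
    rw [h2]
    refine (enorm_integral_le_lintegral_enorm _).trans ((lintegral_mono_ae hy).trans (le_of_eq ?_))
    rw [lintegral_add_right _ measurable_const, lintegral_add_left measurable_const]
    simp [add_assoc]
  refine (lintegral_mono_ae h1).trans (le_of_eq ?_)
  rw [lintegral_add_right _ measurable_const]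
  simp only [lintegral_const, measure_univ, mul_one]
  ring

end Inequalities

/-! ### Norm estimates for the potential. -/

section Boundedness

variable {X : Type*} [MetricSpace X] [MeasurableSpace X] [OpensMeasurableSpace X] {μ : Measure X}
  {N c C K : ℝ} {s : X → X → ℝ → ℝ} {α : ℝ}

theorem IsScaleKernel.exists_potentialMajorant_le_hedberg (hs : IsScaleKernel N K s)
    (H : BallGrowth μ N c C) {p q : ℝ} (hp : 1 < p) (hpq : p < q) (hq : N * (1 / p - 1 / q) ≤ α) :
    ∃ B : ℝ≥0, ∀ g : X → ℝ, MemLp g (ENNReal.ofReal p) μ → ∀ x,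
      potentialMajorant μ s α g x (Ioi 0) ≤
        B * (maximalFunction μ N (fun z => ‖g z‖ₑ) x ^ (p / q) *
          eLpNorm g (ENNReal.ofReal p) μ ^ (1 - p / q)) := by
  have hp0 : 0 < p := by linarith
  have hq0 : 0 < q := by linarith
  have hN := H.dim_pos
  have hC := H.upper_pos
  have hK := hs.const_nonneg
  have hinv : 1 / q < 1 / p := one_div_lt_one_div_of_lt hp0 hpq
  set β := N * (1 / p - 1 / q) with hβ_def
  have hβ : 0 < β := mul_pos hN (sub_pos.2 hinv)
  have hα : 0 < α := hβ.trans_le hq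
  have hβγ : β < N / p := by
    have : 0 < N * (1 / q) := by positivity
    rw [hβ_def, mul_sub, mul_one_div]
    linarith
  -- This identity dictates β: it makes the power of M equal to p/q, so the q-th power of the bound
  -- involves M^p.
  have hθ : β / (N / p) = 1 - p / q := by
    rw [hβ_def]; field_simp
  set A := α / β * (K * 4 ^ N * 2 ^ N) with hA
  set A' := α / (N / p - β) * (K * (C * 4 ^ N) ^ (1 - 1 / p)) with hA'
  have hσ : 0 < N / p - β := sub_pos.2 hβγ
  have hA0 : 0 ≤ A := by positivity
  have hA'0 : 0 ≤ A' := by positivity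
  -- The `+ 1` keeps the constant nonzero, so the bound is ∞ where M is infinite and G is not 0.
  refine ⟨(A + A' + 1).toNNReal, fun g hg x => ?_⟩
  have hB : (((A + A' + 1).toNNReal : ℝ≥0) : ℝ≥0∞) = ENNReal.ofReal (A + A' + 1) := rfl
  have hB0 : ENNReal.ofReal (A + A' + 1) ≠ 0 := (ENNReal.ofReal_pos.2 (by positivity)).ne'
  rw [hB]
  set M := maximalFunction μ N (fun z => ‖g z‖ₑ) x with hM_def
  set G := eLpNorm g (ENNReal.ofReal p) μ with hG_def
  have hzero : (∀ t : ℝ, 0 < t → scaleAverage μ s g x t = 0) →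
      potentialMajorant μ s α g x (Ioi 0) = 0 := by
    intro h0
    unfold potentialMajorant
    rw [setLIntegral_congr_fun (g := fun _ => 0) measurableSet_Ioi fun t ht => by
      simp only [h0 t ht, mul_zero], lintegral_zero]
  -- Balancing needs M and G positive. If either vanishes, so does every scale average.
  rcases eq_or_ne G 0 with hG0 | hG0
  · rw [hzero fun t ht => ?_]
    · exact zero_le
    · have := hs.scaleAverage_le_eLpNorm H hp hg.aestronglyMeasurable x ht
      rw [← hG_def, hG0, mul_zero] at this
      exact le_antisymm this zero_le
  rcases eq_or_ne M 0 with hM0 | hM0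
  · rw [hzero fun t ht => ?_]
    · exact zero_le
    · have := hs.scaleAverage_le_maximalFunction (μ := μ) (g := g) hN x ht
      rw [← hM_def, hM0, mul_zero] at this
      exact le_antisymm this zero_le
  have h1 : 0 < p / q := by positivity
  have h2 : 0 ≤ 1 - p / q := by
    rw [sub_nonneg, div_le_one hq0]; exact hpq.le
  rcases eq_or_ne M ⊤ with hM | hM
  · have h3 : G ^ (1 - p / q) ≠ 0 := fun h => hG0 ((ENNReal.rpow_eq_zero_iff.1 h).elim And.left
      fun h => absurd h.2 (not_lt.2 h2))
    rw [hM, ENNReal.top_rpow_of_pos h1, ENNReal.top_mul h3, ENNReal.mul_top hB0]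
    exact le_top
  · have := le_of_forall_scale_le (Q := potentialMajorant μ s α g x (Ioi 0)) hβ hβγ hA0 hA'0 hM0 hM
      hG0 hg.2.ne fun r hr => by
        rw [potentialMajorant_Ioi_eq_add x hr]
        exact add_le_add (hs.potentialMajorant_Ioc_le_maximalFunction hN hβ hq x hr)
          (hs.potentialMajorant_Ioi_le_eLpNorm H hp hβ.le hq hβγ hg.aestronglyMeasurable x hr)
    rw [hθ, sub_sub_cancel] at this
    exact this.trans (mul_le_mul_left (ENNReal.ofReal_le_ofReal (by linarith)) _)

theorem BallGrowth.exists_lintegral_maximalFunction_rpow_le (H : BallGrowth μ N c C) {p : ℝ}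
    (hp : 1 < p) : ∃ B : ℝ≥0, ∀ g : X → ℝ, MemLp g (ENNReal.ofReal p) μ →
      ∫⁻ x, maximalFunction μ N (fun z => ‖g z‖ₑ) x ^ p ∂μ ≤
        B * eLpNorm g (ENNReal.ofReal p) μ ^ p := by
  have hp0 : 0 < p := by linarith
  obtain ⟨B, hB⟩ := H.lintegral_maximalFunction_rpow_le hp
  refine ⟨B, fun g hg => (hB _ hg.aestronglyMeasurable.enorm).trans (le_of_eq ?_)⟩
  rw [eLpNorm_eq_lintegral_rpow_enorm_toReal (by simpa using hp0) ENNReal.ofReal_ne_top,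
    ENNReal.toReal_ofReal hp0.le, ← ENNReal.rpow_mul, one_div_mul_cancel hp0.ne', ENNReal.rpow_one]

theorem IsScaleKernel.exists_eLpNorm_scalePotential_le (hs : IsScaleKernel N K s)
    (H : BallGrowth μ N c C) {p q : ℝ} (hp : 1 < p) (hpq : p < q) (hα : 0 ≤ α)
    (hq : N * (1 / p - 1 / q) ≤ α) :
    ∃ B : ℝ≥0, ∀ g : X → ℝ, MemLp g (ENNReal.ofReal p) μ →
      eLpNorm (scalePotential μ s α g) (ENNReal.ofReal q) μ ≤
        B * eLpNorm g (ENNReal.ofReal p) μ := by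
  have := H.sigmaFinite
  have hp0 : 0 < p := by linarith
  have hq0 : 0 < q := by linarith
  obtain ⟨B, hB⟩ := hs.exists_potentialMajorant_le_hedberg H hp hpq hq
  obtain ⟨B', hB'⟩ := H.exists_lintegral_maximalFunction_rpow_le hp
  refine ⟨B * B' ^ (1 / q), fun g hg => ?_⟩
  set G := eLpNorm g (ENNReal.ofReal p) μ with hG
  have hGtop : G ≠ ⊤ := hg.2.ne
  have h2 : 0 ≤ 1 - p / q := by
    rw [sub_nonneg, div_le_one hq0]; exact hpq.le
  have h1 : ∫⁻ x, ‖scalePotential μ s α g x‖ₑ ^ q ∂μ ≤ (B : ℝ≥0∞) ^ q * B' * G ^ q := by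
    calc ∫⁻ x, ‖scalePotential μ s α g x‖ₑ ^ q ∂μ
        ≤ ∫⁻ x, (B : ℝ≥0∞) ^ q * G ^ (q - p) *
            maximalFunction μ N (fun z => ‖g z‖ₑ) x ^ p ∂μ := by
          refine lintegral_mono fun x => ?_
          refine (ENNReal.rpow_le_rpow ((hs.enorm_scalePotential_le hα hg.aestronglyMeasurable
            x).trans (hB g hg x)) hq0.le).trans (le_of_eq ?_)
          rw [ENNReal.mul_rpow_of_nonneg _ _ hq0.le, ENNReal.mul_rpow_of_nonneg _ _ hq0.le,
            ← ENNReal.rpow_mul, ← ENNReal.rpow_mul, div_mul_cancel₀ _ hq0.ne', sub_mul, one_mul,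
            div_mul_cancel₀ _ hq0.ne']
          ring
      _ ≤ (B : ℝ≥0∞) ^ q * G ^ (q - p) * (B' * G ^ p) := by
          rw [lintegral_const_mul' _ _ (ENNReal.mul_ne_top
            (ENNReal.rpow_ne_top_of_nonneg hq0.le ENNReal.coe_ne_top)
            (ENNReal.rpow_ne_top_of_nonneg (by linarith) hGtop))]
          exact mul_le_mul_right (hB' g hg) _
      _ = (B : ℝ≥0∞) ^ q * B' * G ^ q := by
          have h3 : G ^ q = G ^ (q - p) * G ^ p := by
            rw [← ENNReal.rpow_add_of_nonneg (q - p) p (by linarith) hp0.le, sub_add_cancel]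
          rw [h3]
          ring
  rw [eLpNorm_eq_lintegral_rpow_enorm_toReal (by simpa using hq0) ENNReal.ofReal_ne_top,
    ENNReal.toReal_ofReal hq0.le]
  refine (ENNReal.rpow_le_rpow h1 (by positivity)).trans (le_of_eq ?_)
  rw [ENNReal.mul_rpow_of_nonneg _ _ (by positivity), ENNReal.mul_rpow_of_nonneg _ _ (by positivity),
    ← ENNReal.rpow_mul, ← ENNReal.rpow_mul, mul_one_div_cancel hq0.ne', ENNReal.rpow_one,
    ENNReal.rpow_one, ENNReal.coe_mul, ENNReal.coe_rpow_of_nonneg _ (by positivity)]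

theorem IsScaleKernel.ae_potentialMajorant_lt_top (hs : IsScaleKernel N K s)
    (H : BallGrowth μ N c C) {p q : ℝ} (hp : 1 < p) (hpq : p < q)
    (hq : N * (1 / p - 1 / q) ≤ α) {g : X → ℝ} (hg : MemLp g (ENNReal.ofReal p) μ) :
    ∀ᵐ x ∂μ, potentialMajorant μ s α g x (Ioi 0) < ⊤ := by
  have hp0 : 0 < p := by linarith
  have hq0 : 0 < q := by linarith
  obtain ⟨B, hB⟩ := hs.exists_potentialMajorant_le_hedberg H hp hpq hq
  obtain ⟨B', hB'⟩ := H.exists_lintegral_maximalFunction_rpow_le hp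
  have hM := H.measurable_maximalFunction_of_aemeasurable hg.aestronglyMeasurable.enorm
  have h2 : 0 ≤ 1 - p / q := by
    rw [sub_nonneg, div_le_one hq0]; exact hpq.le
  have hfin := ae_lt_top' (hM.pow_const p).aemeasurable ((hB' g hg).trans_lt
    (ENNReal.mul_lt_top ENNReal.coe_lt_top (ENNReal.rpow_lt_top_of_nonneg hp0.le hg.2.ne))).ne
  filter_upwards [hfin] with x hx
  refine (hB g hg x).trans_lt (ENNReal.mul_lt_top ENNReal.coe_lt_top (ENNReal.mul_lt_top ?_
    (ENNReal.rpow_lt_top_of_nonneg h2 hg.2.ne)))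
  refine ENNReal.rpow_lt_top_of_nonneg (by positivity) fun h => ?_
  rw [h, ENNReal.top_rpow_of_pos hp0] at hx
  exact hx.ne rfl

/-- Cut at scale 1, using the exponent α below and β = 0 above. -/
theorem IsScaleKernel.exists_potentialMajorant_le_eLpNorm (hs : IsScaleKernel N K s)
    (H : BallGrowth μ N c C) {p : ℝ} (hp : 1 < p) (hαp : N / p < α) :
    ∃ B : ℝ≥0, ∀ g : X → ℝ, AEStronglyMeasurable g μ → ∀ x,
      potentialMajorant μ s α g x (Ioi 0) ≤ B * eLpNorm g (ENNReal.ofReal p) μ := by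
  have hp0 : 0 < p := by linarith
  have hN := H.dim_pos
  have hγ : 0 < N / p := by positivity
  refine ⟨(α / (α - N / p) * (K * (C * 4 ^ N) ^ (1 - 1 / p)) * 1 ^ (α - N / p)).toNNReal +
    (α / (N / p - 0) * (K * (C * 4 ^ N) ^ (1 - 1 / p)) * 1 ^ (0 - N / p)).toNNReal,
    fun g hg x => ?_⟩
  rw [potentialMajorant_Ioi_eq_add x one_pos, ENNReal.coe_add, add_mul]
  exact add_le_add (hs.potentialMajorant_Ioc_le_eLpNorm H hp hαp hg x one_pos)
    (hs.potentialMajorant_Ioi_le_eLpNorm H hp le_rfl (hγ.trans hαp).le hγ hg x one_pos)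

theorem IsScaleKernel.exists_enorm_scalePotential_sub_le (hs : IsScaleKernel N K s)
    (H : BallGrowth μ N c C) {p : ℝ} (hp : 1 < p) (hαp : N / p < α) (hα1 : α < 1 + N / p) :
    ∃ B : ℝ≥0, ∀ g : X → ℝ, MemLp g (ENNReal.ofReal p) μ → ∀ x x',
      ‖scalePotential μ s α g x - scalePotential μ s α g x'‖ₑ ≤
        B * eLpNorm g (ENNReal.ofReal p) μ * edist x x' ^ (α - N / p) := by
  have := H.sigmaFinite
  have hp0 : 0 < p := by linarith
  have hN := H.dim_pos
  have hC := H.upper_pos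
  have hK := hs.const_nonneg
  have hα : 0 < α := lt_trans (by positivity) hαp
  have hβ : 0 < α - N / p := sub_pos.2 hαp
  have hσ : 0 < 1 + N / p - α := sub_pos.2 hα1
  obtain ⟨B, hB⟩ := hs.exists_potentialMajorant_le_eLpNorm H hp hαp
  set A := α / (α - N / p) * (K * (C * 4 ^ N) ^ (1 - 1 / p)) with hA
  set A' := α / (1 + N / p - α) * (2 * K * (C * 6 ^ N) ^ (1 - 1 / p)) with hA'
  have hA0 : 0 ≤ A := by positivity
  have hA'0 : 0 ≤ A' := by positivity
  refine ⟨(A + A + A').toNNReal, fun g hg x x' => ?_⟩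
  have hBtop : ∀ y, potentialMajorant μ s α g y (Ioi 0) < ⊤ := fun y =>
    (hB g hg.aestronglyMeasurable y).trans_lt (ENNReal.mul_lt_top ENNReal.coe_lt_top hg.2)
  rcases eq_or_ne x x' with rfl | hne
  · simp
  have hr : 0 < dist x x' := dist_pos.2 hne
  set r := dist x x' with hr_def
  refine (hs.enorm_scalePotential_sub_le hα.le hg.aestronglyMeasurable hr (hBtop x)
    (hBtop x')).trans ((add_le_add (add_le_add
      (hs.potentialMajorant_Ioc_le_eLpNorm H hp hαp hg.aestronglyMeasurable x hr)
      (hs.potentialMajorant_Ioc_le_eLpNorm H hp hαp hg.aestronglyMeasurable x' hr))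
      (hs.lintegral_Ioi_sub_le H hp hα.le hα1 hg.aestronglyMeasurable hr
        (by linarith : dist x x' ≤ 2 * r))).trans (le_of_eq ?_))
  have hB2 : (((A + A + A').toNNReal : ℝ≥0) : ℝ≥0∞) = ENNReal.ofReal (A + A + A') := rfl
  rw [← add_mul, ← add_mul, ← hA, ← hA', ← ENNReal.ofReal_add (by positivity) (by positivity),
    ← ENNReal.ofReal_add (by positivity) (by positivity), ← add_mul, ← add_mul, hB2, edist_dist,
    ← hr_def, ENNReal.ofReal_rpow_of_pos hr, ENNReal.ofReal_mul (by positivity)]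
  ring

theorem IsScaleKernel.exists_bmoSeminorm_le (hs : IsScaleKernel N K s)
    (H : BallGrowth μ N c C) {p : ℝ} (hp : 1 < p) (hαp : α = N / p) :
    ∃ B : ℝ≥0, ∀ f g : X → ℝ, MemLp g (ENNReal.ofReal p) μ →
      (∀ (x : X) (r : ℝ), IntegrableOn f (Metric.ball x r) μ) →
      f =ᵐ[μ] scalePotential μ s α g →
      bmoSeminorm μ f ≤ B * eLpNorm g (ENNReal.ofReal p) μ := by
  have := H.sigmaFinite
  have hp0 : 0 < p := by linarith
  have hN := H.dim_pos
  have hc := H.lower_pos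
  have hC := H.upper_pos
  have hK := hs.const_nonneg
  have hα : 0 < α := by rw [hαp]; positivity
  have he : 0 ≤ 1 - 1 / p := by
    rw [sub_nonneg, div_le_one hp0]; exact hp.le
  obtain ⟨B', hB'⟩ := H.exists_lintegral_maximalFunction_rpow_le hp
  set A := α / α * (K * 4 ^ N * 2 ^ N) with hA
  set A' := α / (1 + N / p - α) * (2 * K * (C * 6 ^ N) ^ (1 - 1 / p)) with hA'
  have hA0 : 0 ≤ A := by positivity
  refine ⟨2 * (A * (C ^ (1 - 1 / p) / c)).toNNReal * B' ^ (1 / p) + A'.toNNReal,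
    fun f g hg hf hfg => ?_⟩
  have hgm := hg.aestronglyMeasurable
  set G := eLpNorm g (ENNReal.ofReal p) μ with hG
  set M := maximalFunction μ N (fun z => ‖g z‖ₑ) with hM_def
  have hM : Measurable M := H.measurable_maximalFunction_of_aemeasurable hgm.enorm
  have hfin : ∀ᵐ x ∂μ, potentialMajorant μ s α g x (Ioi 0) < ⊤ := by
    -- At α = N/p any finite q > p is admissible; p + 1 is an arbitrary choice.
    refine hs.ae_potentialMajorant_lt_top H hp (q := p + 1) (by linarith) ?_ hg
    have : 0 < N * (1 / (p + 1)) := by positivity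
    rw [hαp, mul_sub, mul_one_div]
    linarith
  refine iSup_le fun x₀ => iSup_le fun r => iSup_le fun hr => ?_
  set S := Metric.ball x₀ r with hS
  have hSm : MeasurableSet S := Metric.isOpen_ball.measurableSet
  have hSpos : μ S ≠ 0 := (H.measure_ball_pos x₀ hr).ne'
  have : IsFiniteMeasure (μ.restrict S) := ⟨by
    rw [Measure.restrict_apply_univ]; exact H.measure_ball_lt_top x₀ r⟩
  have : NeZero (μ.restrict S) := ⟨fun h => hSpos (Measure.restrict_eq_zero.1 h)⟩
  -- The normalised measure behind both averages over the ball.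
  set ν := ((μ.restrict S) univ)⁻¹ • μ.restrict S with hν
  have hac : ∀ {P : X → Prop}, (∀ᵐ x ∂μ, P x) → ∀ᵐ x ∂ν, P x := fun h =>
    Measure.ae_smul_measure (ae_restrict_of_ae h) _
  have hmem : ∀ᵐ x ∂ν, x ∈ S := Measure.ae_smul_measure (ae_restrict_mem hSm) _
  have hfν : Integrable f ν := (hf x₀ r).integrable.smul_measure (by
    rw [Measure.restrict_apply_univ]; exact ENNReal.inv_ne_top.2 hSpos)
  have hosc : ∀ᵐ y ∂ν, ∀ᵐ z ∂ν, ‖f y - f z‖ₑ ≤ ENNReal.ofReal (A * r ^ α) * M y +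
      ENNReal.ofReal (A * r ^ α) * M z + ENNReal.ofReal A' * G := by
    filter_upwards [hac hfin, hac hfg, hmem] with y hy1 hy2 hy3
    filter_upwards [hac hfin, hac hfg, hmem] with z hz1 hz2 hz3
    have hd : dist y z ≤ 2 * r := by
      have h1 : dist y x₀ < r := hy3
      have h2 : dist z x₀ < r := hz3
      linarith [dist_triangle_right y z x₀]
    rw [hy2, hz2]
    refine (hs.enorm_scalePotential_sub_le hα.le hgm hr hy1 hz1).trans (add_le_add (add_le_add
      (hs.potentialMajorant_Ioc_le_maximalFunction hN hα le_rfl y hr)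
      (hs.potentialMajorant_Ioc_le_maximalFunction hN hα le_rfl z hr))
      ((hs.lintegral_Ioi_sub_le H hp hα.le (by rw [hαp]; linarith) hgm hr hd).trans
        (le_of_eq ?_)))
    rw [← hA', hαp, sub_self, Real.rpow_zero, mul_one]
  have hUle : ∫⁻ y, ENNReal.ofReal (A * r ^ α) * M y ∂ν ≤
      ENNReal.ofReal (A * (C ^ (1 - 1 / p) / c)) * (B' : ℝ≥0∞) ^ (1 / p) * G := by
    have h1 : (∫⁻ x, M x ^ p ∂μ) ^ (1 / p) ≤ (B' : ℝ≥0∞) ^ (1 / p) * G := by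
      refine (ENNReal.rpow_le_rpow (hB' g hg) (by positivity)).trans (le_of_eq ?_)
      rw [ENNReal.mul_rpow_of_nonneg _ _ (by positivity), ← ENNReal.rpow_mul,
        mul_one_div_cancel hp0.ne', ENNReal.rpow_one]
    have h2 : μ S ^ (1 - 1 / p) ≤ ENNReal.ofReal ((C * r ^ N) ^ (1 - 1 / p)) := by
      rw [← ENNReal.ofReal_rpow_of_nonneg (by positivity) he]
      exact ENNReal.rpow_le_rpow (H.upper x₀ r hr) he
    have h3 : (μ S)⁻¹ ≤ ENNReal.ofReal ((c * r ^ N)⁻¹) := by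
      rw [ENNReal.ofReal_inv_of_pos (by positivity)]
      exact ENNReal.inv_le_inv.2 (H.lower x₀ r hr)
    -- The powers of r cancel: α - N + N(1 - 1/p) = 0.
    have h4 : A * r ^ α * (c * r ^ N)⁻¹ * (C * r ^ N) ^ (1 - 1 / p)
        = A * (C ^ (1 - 1 / p) / c) := by
      rw [Real.mul_rpow hC.le (by positivity), ← Real.rpow_mul hr.le,
        show N * (1 - 1 / p) = N - α by rw [hαp]; ring, Real.rpow_sub hr]
      field_simp
    rw [hν, lintegral_smul_measure, Measure.restrict_apply_univ, lintegral_const_mul _ hM,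
      smul_eq_mul]
    calc (μ S)⁻¹ * (ENNReal.ofReal (A * r ^ α) * ∫⁻ y in S, M y ∂μ)
        ≤ ENNReal.ofReal ((c * r ^ N)⁻¹) * (ENNReal.ofReal (A * r ^ α) *
          ((B' : ℝ≥0∞) ^ (1 / p) * G * ENNReal.ofReal ((C * r ^ N) ^ (1 - 1 / p)))) := by
          refine mul_le_mul' h3 (mul_le_mul_right ?_ _)
          exact (setLIntegral_le_rpow_mul_measure hp hM.aemeasurable S).trans (mul_le_mul' h1 h2)
      _ = ENNReal.ofReal (A * r ^ α) * ENNReal.ofReal ((c * r ^ N)⁻¹) *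
          ENNReal.ofReal ((C * r ^ N) ^ (1 - 1 / p)) * ((B' : ℝ≥0∞) ^ (1 / p) * G) := by ring
      _ = _ := by
          rw [← ENNReal.ofReal_mul (by positivity), ← ENNReal.ofReal_mul (by positivity), h4,
            ← mul_assoc]
  have hmain := lintegral_enorm_sub_integral_le hfν hosc
  refine hmain.trans ((add_le_add_left (mul_le_mul_right hUle 2) _).trans (le_of_eq ?_))
  have e1 : ((A'.toNNReal : ℝ≥0) : ℝ≥0∞) = ENNReal.ofReal A' := rfl
  have e2 : (((A * (C ^ (1 - 1 / p) / c)).toNNReal : ℝ≥0) : ℝ≥0∞)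
    = ENNReal.ofReal (A * (C ^ (1 - 1 / p) / c)) := rfl
  rw [ENNReal.coe_add, ENNReal.coe_mul, ENNReal.coe_mul, e1, e2,
    ENNReal.coe_rpow_of_nonneg _ (by positivity)]
  push_cast
  ring

end Boundedness

/-! ### From potential estimates to embeddings. -/

section Embeddings

variable {X : Type*} [MetricSpace X] [MeasurableSpace X] {μ : Measure X} {N : ℝ} {h : ℝ → ℝ} {α : ℝ}

/-- A bound by ‖g‖_p for every g representing f passes to the infimum. -/
theorem potentialSpace_embeds {p : ℝ≥0∞} {B : FunctionSpace X} (K : ℝ≥0)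
    (hK : ∀ f g : X → ℝ, MemLp f p μ → MemLp g p μ → f =ᵐ[μ] besselPotential μ N h α g →
      B.mem f ∧ B.norm f ≤ K * eLpNorm g p μ) :
    (potentialSpace μ N h α p).Embeds B := by
  -- A nonzero constant is needed to move it through the infimum, whose inner index set is empty for
  -- inadmissible g: 0 · ∞ = 0.
  refine ⟨K + 1, fun f hf => ?_⟩
  obtain ⟨hfp, g, hg, hfg⟩ := hf
  refine ⟨(hK f g hfp hg hfg).1, ?_⟩
  have h0 : ((K + 1 : ℝ≥0) : ℝ≥0∞) ≠ 0 := by simp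
  have h1 : B.norm f ≤ ((K + 1 : ℝ≥0) : ℝ≥0∞) *
      ⨅ (g : X → ℝ) (_ : MemLp g p μ ∧ f =ᵐ[μ] besselPotential μ N h α g), eLpNorm g p μ := by
    rw [ENNReal.mul_iInf_of_ne h0 ENNReal.coe_ne_top]
    refine le_iInf fun g => ?_
    rw [ENNReal.mul_iInf_of_ne h0 ENNReal.coe_ne_top]
    refine le_iInf fun hg => (hK f g hfp hg.1 hg.2).2.trans (mul_le_mul_left ?_ _)
    exact_mod_cast le_self_add
  exact h1.trans (mul_le_mul_right le_add_self _)

theorem potentialSpace_embeds_self (p : ℝ≥0∞) :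
    (potentialSpace μ N h α p).Embeds (lebesgueSpace μ p) :=
  ⟨1, fun f hf => ⟨hf.1, by
    rw [ENNReal.coe_one, one_mul]
    exact le_self_add⟩⟩

variable [OpensMeasurableSpace X] {c C K : ℝ}

theorem potentialSpace_embeds_lebesgueSpace (H : BallGrowth μ N c C) {s : X → X → ℝ → ℝ}
    (hs : IsScaleKernel N K s) (hJ : ∀ g, besselPotential μ N h α g = scalePotential μ s α g)
    {p q : ℝ} (hp : 1 < p) (hpq : p ≤ q) (hα : 0 ≤ α) (hq : N * (1 / p - 1 / q) ≤ α) :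
    (potentialSpace μ N h α (ENNReal.ofReal p)).Embeds (lebesgueSpace μ (ENNReal.ofReal q)) := by
  rcases hpq.eq_or_lt with rfl | hpq
  · exact potentialSpace_embeds_self _
  obtain ⟨B, hB⟩ := hs.exists_eLpNorm_scalePotential_le H hp hpq hα hq
  refine potentialSpace_embeds B fun f g hf hg hfg => ?_
  rw [hJ] at hfg
  have h1 : eLpNorm f (ENNReal.ofReal q) μ ≤ B * eLpNorm g (ENNReal.ofReal p) μ := by
    rw [eLpNorm_congr_ae hfg]
    exact hB g hg
  exact ⟨⟨hf.1, h1.trans_lt (ENNReal.mul_lt_top ENNReal.coe_lt_top hg.2)⟩, h1⟩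

theorem potentialSpace_embeds_lebesgueSpace_top (H : BallGrowth μ N c C) {s : X → X → ℝ → ℝ}
    (hs : IsScaleKernel N K s) (hJ : ∀ g, besselPotential μ N h α g = scalePotential μ s α g)
    {p : ℝ} (hp : 1 < p) (hα : 0 ≤ α) (hαp : N / p < α) :
    (potentialSpace μ N h α (ENNReal.ofReal p)).Embeds (lebesgueSpace μ ⊤) := by
  have := H.sigmaFinite
  obtain ⟨B, hB⟩ := hs.exists_potentialMajorant_le_eLpNorm H hp hαp
  refine potentialSpace_embeds B fun f g hf hg hfg => ?_
  rw [hJ] at hfg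
  have h1 : eLpNorm f ⊤ μ ≤ B * eLpNorm g (ENNReal.ofReal p) μ := by
    rw [eLpNorm_congr_ae hfg, eLpNorm_exponent_top]
    exact essSup_le_of_ae_le _ (ae_of_all _ fun x =>
      (hs.enorm_scalePotential_le hα hg.aestronglyMeasurable x).trans
        (hB g hg.aestronglyMeasurable x))
  exact ⟨⟨hf.1, h1.trans_lt (ENNReal.mul_lt_top ENNReal.coe_lt_top hg.2)⟩, h1⟩

theorem potentialSpace_embeds_bmoSpace (H : BallGrowth μ N c C) {s : X → X → ℝ → ℝ}
    (hs : IsScaleKernel N K s) (hJ : ∀ g, besselPotential μ N h α g = scalePotential μ s α g)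
    {p : ℝ} (hp : 1 < p) (hαp : α = N / p) :
    (potentialSpace μ N h α (ENNReal.ofReal p)).Embeds (bmoSpace μ) := by
  obtain ⟨B, hB⟩ := hs.exists_bmoSeminorm_le H hp hαp
  refine potentialSpace_embeds B fun f g hf hg hfg => ?_
  rw [hJ] at hfg
  have hint : ∀ (x : X) (r : ℝ), IntegrableOn f (Metric.ball x r) μ := fun x r => by
    have : IsFiniteMeasure (μ.restrict (Metric.ball x r)) := ⟨by
      rw [Measure.restrict_apply_univ]; exact H.measure_ball_lt_top x r⟩
    exact (hf.restrict _).integrable (by simpa using hp.le)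
  have h1 := hB f g hg hint hfg
  exact ⟨⟨fun x r _ => hint x r,
    h1.trans_lt (ENNReal.mul_lt_top ENNReal.coe_lt_top hg.2)⟩, h1⟩

/-- The representative is the potential itself, for which both estimates hold at every point. -/
theorem potentialSpace_embeds_holderSpace (H : BallGrowth μ N c C) {s : X → X → ℝ → ℝ}
    (hs : IsScaleKernel N K s) (hJ : ∀ g, besselPotential μ N h α g = scalePotential μ s α g)
    {p : ℝ} (hp : 1 < p) (hα : 0 ≤ α) (hαp : N / p < α) (hα1 : α < 1 + N / p) :
    (potentialSpace μ N h α (ENNReal.ofReal p)).Embeds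
      (holderSpace μ (α - N / p).toNNReal) := by
  have := H.sigmaFinite
  obtain ⟨B, hB⟩ := hs.exists_potentialMajorant_le_eLpNorm H hp hαp
  obtain ⟨B', hB'⟩ := hs.exists_enorm_scalePotential_sub_le H hp hαp hα1
  refine potentialSpace_embeds (B + B') fun f g hf hg hfg => ?_
  rw [hJ] at hfg
  set u := scalePotential μ s α g with hu
  have h1 : (⨆ x, ‖u x‖ₑ) ≤ B * eLpNorm g (ENNReal.ofReal p) μ := iSup_le fun x =>
    (hs.enorm_scalePotential_le hα hg.aestronglyMeasurable x).trans
      (hB g hg.aestronglyMeasurable x)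
  have h2 : HolderWith (B' * (eLpNorm g (ENNReal.ofReal p) μ).toNNReal)
      (α - N / p).toNNReal u := by
    intro x x'
    rw [edist_eq_enorm_sub, ENNReal.coe_mul, ENNReal.coe_toNNReal hg.2.ne,
      Real.coe_toNNReal _ (sub_pos.2 hαp).le]
    exact hB' g hg x x'
  have h3 := h2.eHolderNorm_le
  rw [ENNReal.coe_mul, ENNReal.coe_toNNReal hg.2.ne] at h3
  refine ⟨⟨u, hfg, h1.trans_lt (ENNReal.mul_lt_top ENNReal.coe_lt_top hg.2), h2.memHolder⟩, ?_⟩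
  refine (iInf₂_le u hfg).trans ?_
  rw [ENNReal.coe_add, add_mul]
  exact add_le_add h1 h3

end Embeddings

end AhlforsBessel

/-! ### Assembly: translating the exponent conditions. -/

theorem mainTheorem6 {X : Type*} [MetricSpace X] [MeasurableSpace X] [OpensMeasurableSpace X]
    (μ : Measure X) (N : ℝ) (hreg : AhlforsBessel.IsAhlforsRegular μ N) (hμ : μ univ = ⊤)
    (h : ℝ → ℝ) (hh : AhlforsBessel.IsCutoff h)
    (α : ℝ) (hα : 0 < α) (p : ℝ) (hp : 1 < p) :
    (p < N / α → ∀ pstar : ℝ, 1 / pstar = 1 / p - α / N →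
      ∀ q : ℝ, p ≤ q → q ≤ pstar →
        (AhlforsBessel.potentialSpace μ N h α (ENNReal.ofReal p)).Embeds
          (AhlforsBessel.lebesgueSpace μ (ENNReal.ofReal q))) ∧
    (p = N / α →
      (∀ q : ℝ, p ≤ q →
        (AhlforsBessel.potentialSpace μ N h α (ENNReal.ofReal p)).Embeds
          (AhlforsBessel.lebesgueSpace μ (ENNReal.ofReal q))) ∧
      (α < 1 →
        (AhlforsBessel.potentialSpace μ N h α (ENNReal.ofReal p)).Embeds
          (AhlforsBessel.bmoSpace μ))) ∧
    (N / α < p →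
      (∀ q : ℝ≥0∞, ENNReal.ofReal p ≤ q →
        (AhlforsBessel.potentialSpace μ N h α (ENNReal.ofReal p)).Embeds
          (AhlforsBessel.lebesgueSpace μ q)) ∧
      (α < 1 + N / p →
        (AhlforsBessel.potentialSpace μ N h α (ENNReal.ofReal p)).Embeds
          (AhlforsBessel.holderSpace μ (α - N / p).toNNReal))) := by
  open AhlforsBessel in
  obtain ⟨c, C, H⟩ := hreg.exists_ballGrowth hμ
  have := H.secondCountableTopology
  have := H.sigmaFinite
  obtain ⟨η, L, hη, hηh⟩ := hh.exists_isLipschitzCutoff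
  obtain ⟨K, hs⟩ := H.exists_isScaleKernel hη
  have hJ : ∀ g : X → ℝ, besselPotential μ N h α g = scalePotential μ (kernelS μ N η) α g :=
    fun g => by rw [besselPotential_congr hηh, besselPotential_eq_scalePotential]
  have hN := H.dim_pos
  have hp0 : 0 < p := by linarith
  -- In the critical and supercritical cases every finite q ≥ p meets the Hedberg condition.
  have hexp : ∀ {q : ℝ}, p ≤ q → N / p ≤ α → N * (1 / p - 1 / q) ≤ α := fun {q} hpq hle => by
    have h1 : 0 < N * (1 / q) := mul_pos hN (one_div_pos.2 (hp0.trans_le hpq))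
    rw [mul_sub, mul_one_div]
    linarith
  refine ⟨fun _ pstar hpstar q hpq hq => ?_, fun hpN => ?_, fun hpN => ?_⟩
  · refine potentialSpace_embeds_lebesgueSpace H hs hJ hp hpq hα.le ?_
    have h1 : 1 / pstar ≤ 1 / q := one_div_le_one_div_of_le (hp0.trans_le hpq) hq
    have h2 : 1 / p - 1 / q ≤ α / N := by linarith
    calc N * (1 / p - 1 / q) ≤ N * (α / N) := mul_le_mul_of_nonneg_left h2 hN.le
      _ = α := mul_div_cancel₀ _ hN.ne'
  · have hαp : α = N / p := by rw [hpN]; field_simp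
    exact ⟨fun q hpq => potentialSpace_embeds_lebesgueSpace H hs hJ hp hpq hα.le
      (hexp hpq hαp.ge), fun _ => potentialSpace_embeds_bmoSpace H hs hJ hp hαp⟩
  · have hαp : N / p < α := by
      rw [div_lt_iff₀ hp0, mul_comm]
      exact (div_lt_iff₀ hα).1 hpN
    refine ⟨fun q hpq => ?_, potentialSpace_embeds_holderSpace H hs hJ hp hα.le hαp⟩
    rcases eq_or_ne q ⊤ with rfl | hq
    · exact potentialSpace_embeds_lebesgueSpace_top H hs hJ hp hα.le hαp
    · rw [← ENNReal.ofReal_toReal hq] at hpq ⊢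
      have hpq' := (ENNReal.ofReal_le_ofReal_iff ENNReal.toReal_nonneg).1 hpq
      exact potentialSpace_embeds_lebesgueSpace H hs hJ hp hpq' hα.le (hexp hpq' hαp.le)
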